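/- Let $\mathbb{F}_q$ be a finite field of characteristic different from $3$, let $\zeta\in\overline{\mathbb{F}}_q$ be a primitive third root of unity, and let $X\to\mathbb{P}^1_t$ be an elliptic surface with zero section over $\mathbb{F}_q$, i.e. its generic fibre is an elliptic curve over $\mathbb{F}_q(t)$ given by a Weierstrass equation. Let $\mathcal{E}\to\mathbb{P}^1_s$ be its base change along $$t=\phi(s)=\frac{s^3-3s^2+1}{3s^2-3s},$$ a Galois cover of $\mathbb{P}^1_t$ with group generated by $\sigma:s\mapsto (s-1)/s$. Let $X_{\mathrm{We}}\to\mathbb{P}^1_t$ and $\mathcal{E}_{\mathrm{We}}\to\mathbb{P}^1_s$ be the Weierstrass models, i.e. the complete models given locally on the base by minimal projective Weierstrass equations (with coefficients in the function field of the base). Let $X_{\mathrm{We},t}$ be the fibre of $X_{\mathrm{We}}$ above $t$, let $\sigma$ also denote the automorphism of $\mathcal{E}_{\mathrm{We}}$ induced by $\sigma$, let $\mathrm{Fr}_q$ be the $q$-Frobenius on $\mathcal{E}_{\mathrm{We}}(\overline{\mathbb{F}}_q)$, and for $i=0,1,2$ put $\mathrm{Fr}_q^{(i)}=\mathrm{Fr}_q\circ\sigma^i$.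 Define $$\begin{aligned}K^{(0)}&=\{t\in\mathbb{F}_q \mid x^3-3(t+1)x^2+3tx+1 \text{ divides } x^q-x\}\cup\{\infty\},\\ K^{(2)}&=\{t\in\mathbb{F}_q \mid x^3-3(t+1)x^2+3tx+1 \text{ divides } x^{q+1}-x+1\},\\ K^{(1)}&=\mathbb{F}_q-K^{(0)}-K^{(2)}-\{\zeta,\zeta^2\}.\end{aligned}$$ Then $K^{(i)}\subset\mathbb{P}^1_t-\{\zeta,\zeta^2\}$, the sets $X_{\mathrm{We},t}(\mathbb{F}_q)$ for $t\in\mathbb{P}^1(\mathbb{F}_q)$ and the set of fixed points of $\mathrm{Fr}_q^{(i)}$ on $\mathcal{E}_{\mathrm{We}}(\overline{\mathbb{F}}_q)$ are finite, and the number of these fixed points is $$\#\mathrm{Fix}(\mathrm{Fr}_q^{(i)}\mid\mathcal{E}_{\mathrm{We}})=3\sum_{t\in K^{(i)}}\#X_{\mathrm{We},t}(\mathbb{F}_q)+R^{(i)},$$ where $R^{(i)}$ is the number of points fixed by $\mathrm{Fr}_q^{(i)}$ in the fibres of $\mathcal{E}_{\mathrm{We}}$ above $-\zeta$ and $-\zeta^2$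 (the ramification points of $\phi$). -/

import Mathlib

open scoped Polynomial OnePoint

namespace EllipticSurface

section RationalFunctions

variable {k : Type*} [Field k]

/-- Substitution `f ↦ f(g)` of a non-constant rational function `g`. -/
noncomputable def subst (g : RatFunc k) (hg : ¬ ∃ c, g = RatFunc.C c) :
    RatFunc k →ₐ[k] RatFunc k :=
  RatFunc.liftAlgHom (Polynomial.aeval g)
    (nonZeroDivisors_le_comap_nonZeroDivisors_of_injective _
      (transcendental_iff_injective.mp (RatFunc.transcendental_of_ne_C g hg)))

theorem subst_X (g : RatFunc k) (hg : ¬ ∃ c, g = RatFunc.C c) :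
    subst g hg RatFunc.X = g := by
  have := RatFunc.liftAlgHom_apply_div (L := RatFunc k) (S := k) (Polynomial.aeval g)
    (nonZeroDivisors_le_comap_nonZeroDivisors_of_injective _
      (transcendental_iff_injective.mp (RatFunc.transcendental_of_ne_C g hg))) Polynomial.X 1
  simpa [subst] using this

theorem algHom_ext_X {f g : RatFunc k →ₐ[k] RatFunc k} (h : f RatFunc.X = g RatFunc.X) :
    f = g := by
  apply IsLocalization.algHom_ext (nonZeroDivisors k[X])
  apply Polynomial.algHom_ext
  change f (algebraMap k[X] (RatFunc k) Polynomial.X) = g (algebraMap k[X] (RatFunc k) Polynomial.X)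
  rwa [RatFunc.algebraMap_X]

/-- A quotient `a / b` of polynomials is non-constant if `a` is not a multiple of `b` by a
constant. -/
theorem ne_C_of_mul_eq {g : RatFunc k} {a b : k[X]} (hb : b ≠ 0)
    (hg : g = algebraMap k[X] (RatFunc k) a / algebraMap k[X] (RatFunc k) b)
    (h : ∀ c : k, a ≠ Polynomial.C c * b) : ¬ ∃ c, g = RatFunc.C c := by
  rintro ⟨c, hc⟩
  have hb' : algebraMap k[X] (RatFunc k) b ≠ 0 := by
    simpa using hb
  rw [hg, div_eq_iff hb', ← RatFunc.algebraMap_C, ← map_mul] at hc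
  exact h c (RatFunc.algebraMap_injective k hc)

theorem inv_ne_C : ¬ ∃ c, (RatFunc.X⁻¹ : RatFunc k) = RatFunc.C c := by
  refine ne_C_of_mul_eq (a := 1) (b := Polynomial.X) Polynomial.X_ne_zero (by simp) ?_
  intro c h
  have := congrArg (Polynomial.eval 0) h
  simp at this

/-- The rational function `(X - 1) / X`. -/
noncomputable def sigmaFun (k : Type*) [Field k] : RatFunc k := (RatFunc.X - 1) / RatFunc.X

/-- The rational function `1 / (1 - X)`. -/
noncomputable def sigmaInvFun (k : Type*) [Field k] : RatFunc k := 1 / (1 - RatFunc.X)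

theorem sigmaFun_ne_C : ¬ ∃ c, sigmaFun k = RatFunc.C c := by
  refine ne_C_of_mul_eq (a := Polynomial.X - 1) (b := Polynomial.X) Polynomial.X_ne_zero
    (by simp [sigmaFun]) ?_
  intro c h
  have := congrArg (Polynomial.eval 0) h
  simp at this

theorem sigmaInvFun_ne_C : ¬ ∃ c, sigmaInvFun k = RatFunc.C c := by
  refine ne_C_of_mul_eq (a := 1) (b := 1 - Polynomial.X) ?_ (by simp [sigmaInvFun]) ?_
  · intro h
    have := congrArg (Polynomial.eval 0) h
    simp at this
  · intro c h
    have := congrArg (Polynomial.eval 1) h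
    simp at this

theorem one_sub_X_ne_zero : (1 - RatFunc.X : RatFunc k) ≠ 0 := by
  intro h
  exact sigmaInvFun_ne_C (k := k) ⟨0, by simp [sigmaInvFun, h]⟩

/-- The rational function `φ = (X³ - 3X² + 1) / (3X² - 3X)`. -/
noncomputable def phiFun (k : Type*) [Field k] : RatFunc k :=
  (RatFunc.X ^ 3 - 3 * RatFunc.X ^ 2 + 1) / (3 * RatFunc.X ^ 2 - 3 * RatFunc.X)

theorem phiFun_ne_C [h3 : NeZero (3 : k)] : ¬ ∃ c, phiFun k = RatFunc.C c := by
  have h3' := h3.out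
  refine ne_C_of_mul_eq (a := Polynomial.X ^ 3 - 3 * Polynomial.X ^ 2 + 1)
    (b := 3 * Polynomial.X ^ 2 - 3 * Polynomial.X) ?_ (by simp [phiFun, map_ofNat]) ?_
  · intro h
    have := congrArg (fun p => Polynomial.coeff p 1) h
    simp [← Polynomial.C_ofNat, Polynomial.coeff_X_pow, h3'] at this
  · intro c h
    have := congrArg (fun p => Polynomial.eval 0 p) h
    simp at this

end RationalFunctions

section Points

/-- The rational functions that are regular at the point `x` of the affine line. -/
noncomputable def affineRing (k : Type*) [Field k] {L : Type*} [Field L] [Algebra k L] (x : L) :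
    Subring (RatFunc k) where
  carrier := {f | Polynomial.aeval x f.denom ≠ 0}
  mul_mem' {f g} hf hg := by
    intro h
    have := Polynomial.eval₂_eq_zero_of_dvd_of_eval₂_eq_zero (algebraMap k L) x
      (RatFunc.denom_mul_dvd f g) h
    rw [Polynomial.eval₂_mul] at this
    cases mul_eq_zero.mp this <;> contradiction
  one_mem' := by simp
  add_mem' {f g} hf hg := by
    intro h
    have := Polynomial.eval₂_eq_zero_of_dvd_of_eval₂_eq_zero (algebraMap k L) x
      (RatFunc.denom_add_dvd f g) h
    rw [Polynomial.eval₂_mul] at this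
    cases mul_eq_zero.mp this <;> contradiction
  zero_mem' := by simp
  neg_mem' {f} hf := by
    intro h
    have h2 : (-f).denom ∣ f.denom := by
      rw [RatFunc.denom_dvd f.denom_ne_zero]
      exact ⟨-f.num, by rw [map_neg, neg_div, RatFunc.num_div_denom]⟩
    exact hf (Polynomial.eval₂_eq_zero_of_dvd_of_eval₂_eq_zero (algebraMap k L) x h2 h)
/-- Evaluation of regular functions at the point `x` of the affine line. -/
noncomputable def affineEval (k : Type*) [Field k] {L : Type*} [Field L] [Algebra k L] (x : L) :
    affineRing k x →+* L where
  toFun f := Polynomial.aeval x f.1.num / Polynomial.aeval x f.1.denom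
  map_one' := by simp
  map_zero' := by simp
  map_mul' f g := by
    have h := congrArg (Polynomial.aeval x) (RatFunc.num_denom_mul f.1 g.1)
    simp only [map_mul] at h
    rw [div_mul_div_comm, div_eq_div_iff (f * g).2 (mul_ne_zero f.2 g.2)]
    exact h
  map_add' f g := by
    have h := congrArg (Polynomial.aeval x) (RatFunc.num_denom_add f.1 g.1)
    simp only [map_mul, map_add] at h
    rw [div_add_div _ _ f.2 g.2, div_eq_div_iff (f + g).2 (mul_ne_zero f.2 g.2)]
    exact h

/-- A point of the projective line is moved to the affine line, by the identity if it is finite,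
and by `X ↦ 1 / X` if it is the point at infinity. -/
noncomputable def chart (k : Type*) [Field k] {L : Type*} [Field L] :
    OnePoint L → (RatFunc k →ₐ[k] RatFunc k) × L :=
  fun p => p.elim (subst RatFunc.X⁻¹ inv_ne_C, 0) (fun x => (AlgHom.id k _, x))

/-- The local ring, in the function field `k(X)` of the projective line over `k`, of the (closed)
point below the `L`-valued point `p`: the functions that are regular at `p`. -/
noncomputable def localRing (k : Type*) [Field k] {L : Type*} [Field L] [Algebra k L]
    (p : OnePoint L) : Subring (RatFunc k) :=
  (affineRing k (chart k p).2).comap (chart k p).1.toRingHom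

/-- The value at `p` of a function that is regular at `p`. -/
noncomputable def evalAt (k : Type*) [Field k] {L : Type*} [Field L] [Algebra k L]
    (p : OnePoint L) : localRing k p →+* L :=
  (affineEval k (chart k p).2).comp
    ((chart k p).1.toRingHom.restrict (localRing k p) (affineRing k (chart k p).2)
      (fun _ h => h))

theorem chart_chart {k L : Type*} [Field k] [Field L] (p : OnePoint L) (f : RatFunc k) :
    (chart k p).1 ((chart k p).1 f) = f := by
  induction p using OnePoint.rec with
  | infty =>
    have : (subst RatFunc.X⁻¹ inv_ne_C).comp (subst RatFunc.X⁻¹ inv_ne_C) = AlgHom.id k _ :=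
      algHom_ext_X (by simp [subst_X])
    exact congrArg (fun e => e f) this
  | coe x => rfl

variable {k : Type*} [Field k] {L : Type*} [Field L] [Algebra k L]

theorem algebraMap_mem_affineRing (x : L) (a : k[X]) :
    algebraMap k[X] (RatFunc k) a ∈ affineRing k x := by
  simp [affineRing]

theorem mem_affineRing_of_div {x : L} {a b : k[X]} (hb : Polynomial.aeval x b ≠ 0) :
    algebraMap k[X] (RatFunc k) a / algebraMap k[X] (RatFunc k) b ∈ affineRing k x := by
  intro h
  exact hb (Polynomial.eval₂_eq_zero_of_dvd_of_eval₂_eq_zero (algebraMap k L) x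
    (RatFunc.denom_div_dvd a b) h)

theorem affineRing_isDVR_and_isFractionRing [Algebra.IsAlgebraic k L] (x : L) :
    IsDiscreteValuationRing (affineRing k x) ∧ IsFractionRing (affineRing k x) (RatFunc k) := by
  let P : Ideal k[X] := RingHom.ker (Polynomial.aeval (R := k) x)
  have hP : P.IsPrime := RingHom.ker_isPrime _
  have hP0 : P ≠ ⊥ := by
    obtain ⟨a, ha, hx⟩ := Algebra.IsAlgebraic.isAlgebraic (R := k) x
    intro h
    exact ha (by simpa [h] using (show a ∈ P from hx))
  let i : k[X] →+* affineRing k x :=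
    (algebraMap k[X] (RatFunc k)).codRestrict _ (algebraMap_mem_affineRing x)
  let _ : Algebra k[X] (affineRing k x) := i.toAlgebra
  have : IsScalarTower k[X] (affineRing k x) (RatFunc k) := IsScalarTower.of_algebraMap_eq' rfl
  have : IsLocalization.AtPrime (affineRing k x) P := by
    refine ⟨⟨?_, ?_, ?_⟩⟩
    · rintro ⟨b, hb⟩
      have hb' : Polynomial.aeval x b ≠ 0 := hb
      have hb0 : b ≠ 0 := fun h => hb' (by simp [h])
      refine IsUnit.of_mul_eq_one ⟨_, mem_affineRing_of_div (a := 1) hb'⟩ ?_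
      apply Subtype.ext
      change algebraMap k[X] (RatFunc k) b * _ = 1
      have : algebraMap k[X] (RatFunc k) b ≠ 0 := by simpa using hb0
      simp [this]
    · rintro ⟨f, hf⟩
      refine ⟨⟨f.num, ⟨f.denom, hf⟩⟩, ?_⟩
      apply Subtype.ext
      change f * algebraMap k[X] (RatFunc k) f.denom = algebraMap k[X] (RatFunc k) f.num
      conv_lhs => rw [← RatFunc.num_div_denom f]
      have : algebraMap k[X] (RatFunc k) f.denom ≠ 0 := by simpa using f.denom_ne_zero
      rw [RatFunc.num_div_denom, ← eq_div_iff this, RatFunc.num_div_denom]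
    · intro a b h
      refine ⟨1, ?_⟩
      have : algebraMap k[X] (RatFunc k) a = algebraMap k[X] (RatFunc k) b :=
        congrArg Subtype.val h
      simpa using RatFunc.algebraMap_injective k this
  refine ⟨IsLocalization.AtPrime.isDiscreteValuationRing_of_dedekind_domain k[X] hP0 _, ?_⟩
  exact IsFractionRing.isFractionRing_of_isDomain_of_isLocalization P.primeCompl _ _

/-- The chart identifies the local ring of a point with that of a point of the affine line. -/
noncomputable def localRingEquiv (p : OnePoint L) :
    localRing k p ≃+* affineRing k (chart k p).2 where
  toFun f := ⟨(chart k p).1 f, f.2⟩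
  invFun f := ⟨(chart k p).1 f, by
    change (chart k p).1 ((chart k p).1 _) ∈ affineRing k _
    rw [chart_chart]; exact f.2⟩
  left_inv f := Subtype.ext (chart_chart p _)
  right_inv f := Subtype.ext (chart_chart p _)
  map_mul' f g := Subtype.ext (map_mul (chart k p).1 _ _)
  map_add' f g := Subtype.ext (map_add (chart k p).1 _ _)

instance [Algebra.IsAlgebraic k L] (p : OnePoint L) : IsDiscreteValuationRing (localRing k p) :=
  have := (affineRing_isDVR_and_isFractionRing (k := k) (chart k p).2).1
  IsDiscreteValuationRing.RingEquivClass.isDiscreteValuationRing (localRingEquiv p).symm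

instance [Algebra.IsAlgebraic k L] (p : OnePoint L) :
    IsFractionRing (localRing k p) (RatFunc k) := by
  have := (affineRing_isDVR_and_isFractionRing (k := k) (chart k p).2).2
  refine IsFractionRing.of_field _ _ fun f => ?_
  obtain ⟨a, b, hb, h⟩ := IsFractionRing.div_surjective (A := affineRing k (chart k p).2)
    ((chart k p).1 f)
  refine ⟨(localRingEquiv p).symm a, (localRingEquiv p).symm b, ?_⟩
  rw [← chart_chart p f, ← h, map_div₀]
  rfl


theorem affineEval_apply {x : L} (f : affineRing k x) :
    affineEval k x f = Polynomial.aeval x f.1.num / Polynomial.aeval x f.1.denom := rfl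

/-- Every element with non-zero value is a unit. -/
theorem div_mem_affineRing {x : L} (a b : affineRing k x) (hb : affineEval k x b ≠ 0) :
    ∃ h : (a / b : RatFunc k) ∈ affineRing k x,
      affineEval k x ⟨a / b, h⟩ = affineEval k x a / affineEval k x b := by
  have hmem : (a / b : RatFunc k) ∈ affineRing k x := by
    have hb1 : Polynomial.aeval x b.1.num ≠ 0 := by
      intro h
      apply hb
      rw [affineEval_apply, h, zero_div]
    have : (b : RatFunc k)⁻¹ ∈ affineRing k x := by
      rw [← RatFunc.num_div_denom (b : RatFunc k), inv_div]
      exact mem_affineRing_of_div hb1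
    rw [div_eq_mul_inv]
    exact (affineRing k x).mul_mem a.2 this
  have hb0 : (b : RatFunc k) ≠ 0 := by
    intro h
    apply hb
    rw [show b = 0 from Subtype.ext h, map_zero]
  refine ⟨hmem, ?_⟩
  rw [eq_div_iff hb, ← map_mul]
  congr 1
  exact Subtype.ext (div_mul_cancel₀ _ hb0)

/-- Substitution is compatible with evaluation. -/
theorem affineEval_subst {x y : L} {g : RatFunc k} {hg : ¬ ∃ c, g = RatFunc.C c}
    (hx : g ∈ affineRing k x) (hy : affineEval k x ⟨g, hx⟩ = y) {f : RatFunc k}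
    (hf : f ∈ affineRing k y) :
    ∃ h : subst g hg f ∈ affineRing k x,
      affineEval k x ⟨subst g hg f, h⟩ = affineEval k y ⟨f, hf⟩ := by
  have key : ∀ a : k[X], ∃ h : subst g hg (algebraMap k[X] (RatFunc k) a) ∈ affineRing k x,
      affineEval k x ⟨_, h⟩ = Polynomial.aeval y a := by
    intro a
    induction a using Polynomial.induction_on' with
    | add p q hp hq =>
      obtain ⟨hp, hp'⟩ := hp
      obtain ⟨hq, hq'⟩ := hq
      refine ⟨by rw [map_add, map_add]; exact Subring.add_mem _ hp hq, ?_⟩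
      rw [map_add (Polynomial.aeval y), ← hp', ← hq', ← (affineEval k x).map_add]
      congr 1
      exact Subtype.ext (by simp)
    | monomial n c =>
      have hc : RatFunc.C c ∈ affineRing k x := by
        rw [← RatFunc.algebraMap_C]; exact algebraMap_mem_affineRing x _
      have e : subst g hg (algebraMap k[X] (RatFunc k) (Polynomial.monomial n c)) =
          RatFunc.C c * g ^ n := by
        rw [← Polynomial.C_mul_X_pow_eq_monomial, map_mul, map_mul, map_pow, map_pow,
          RatFunc.algebraMap_X, subst_X, RatFunc.algebraMap_C]
        congr 1
        exact (subst g hg).commutes c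
      have hm : (⟨RatFunc.C c, hc⟩ * ⟨g, hx⟩ ^ n : affineRing k x).1 = RatFunc.C c * g ^ n := by
        simp
      refine ⟨by rw [e, ← hm]; exact Subtype.mem _, ?_⟩
      have : (⟨subst g hg (algebraMap k[X] (RatFunc k) (Polynomial.monomial n c)),
          by rw [e, ← hm]; exact Subtype.mem _⟩ : affineRing k x) =
          ⟨RatFunc.C c, hc⟩ * ⟨g, hx⟩ ^ n := Subtype.ext (e.trans hm.symm)
      rw [this, map_mul, map_pow, hy, Polynomial.aeval_monomial]
      congr 1
      rw [affineEval_apply]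
      simp
  obtain ⟨hn, hn'⟩ := key f.num
  obtain ⟨hd, hd'⟩ := key f.denom
  have hd0 : affineEval k x ⟨_, hd⟩ ≠ 0 := by rw [hd']; exact hf
  obtain ⟨h, h'⟩ := div_mem_affineRing ⟨_, hn⟩ ⟨_, hd⟩ hd0
  have e : subst g hg f = subst g hg (algebraMap k[X] (RatFunc k) f.num) /
      subst g hg (algebraMap k[X] (RatFunc k) f.denom) := by
    rw [← map_div₀, RatFunc.num_div_denom]
  refine ⟨by rw [e]; exact h, ?_⟩
  simp only [e]
  rw [h', hn', hd', affineEval_apply]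

end Points

section Transport

variable {k : Type*} [Field k] {L : Type*} [Field L] [Algebra k L] {L' : Type*} [Field L']
  [Algebra k L']

/-- The automorphism `e` of the function field identifies the functions that are regular at `p`
with those that are regular at `q`, and `τ` identifies the values. -/
structure Compatible (e : RatFunc k ≃ₐ[k] RatFunc k) (τ : L →ₐ[k] L') (p : OnePoint L)
    (q : OnePoint L') : Prop where
  mem_iff : ∀ f, e f ∈ localRing k q ↔ f ∈ localRing k p
  eval_eq : ∀ f (hf : f ∈ localRing k p) (hf' : e f ∈ localRing k q),
    evalAt k q ⟨e f, hf'⟩ = τ (evalAt k p ⟨f, hf⟩)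

theorem compatible_map (τ : L →ₐ[k] L') (p : OnePoint L) :
    Compatible AlgEquiv.refl τ p (p.map τ) := by
  have hx : ∀ (x : L) (a : k[X]), Polynomial.aeval (τ x) a = τ (Polynomial.aeval x a) :=
    fun x a => Polynomial.aeval_algHom_apply τ x a
  have hc : chart k (p.map τ) = ((chart k p).1, τ (chart k p).2) := by
    induction p using OnePoint.rec with
    | infty => simp [chart]
    | coe x => rfl
  constructor
  · intro f
    change (chart k (p.map τ)).1 f ∈ affineRing k (chart k (p.map τ)).2 ↔
      (chart k p).1 f ∈ affineRing k (chart k p).2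
    rw [hc]
    change Polynomial.aeval (τ _) _ ≠ 0 ↔ Polynomial.aeval _ _ ≠ 0
    rw [hx]
    simp
  · intro f hf hf'
    change Polynomial.aeval (chart k (p.map τ)).2 ((chart k (p.map τ)).1 f).num /
        Polynomial.aeval (chart k (p.map τ)).2 ((chart k (p.map τ)).1 f).denom =
      τ (Polynomial.aeval (chart k p).2 ((chart k p).1 f).num /
        Polynomial.aeval (chart k p).2 ((chart k p).1 f).denom)
    rw [hc]
    rw [hx, hx, map_div₀]

/-- The automorphism `s ↦ (s - 1) / s` of the projective line. -/
noncomputable def sigmaPoint {L : Type*} [Field L] : OnePoint L → OnePoint L :=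
  open Classical in
  fun p => p.elim ((1 : L) : OnePoint L) fun x => if x = 0 then ∞ else (((x - 1) / x : L) : OnePoint L)

theorem sigmaPoint_sigmaPoint_sigmaPoint (p : OnePoint L) :
    sigmaPoint (sigmaPoint (sigmaPoint p)) = p := by
  induction p using OnePoint.rec with
  | infty => simp [sigmaPoint]
  | coe x =>
    by_cases h0 : x = 0
    · simp [sigmaPoint, h0]
    · by_cases h1 : x = 1
      · simp [sigmaPoint, h1]
      · have : x - 1 ≠ 0 := sub_ne_zero.mpr h1
        have h2 : (x - 1) / x - 1 ≠ 0 := by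
          rw [div_sub_one h0]; simp [h0]
        simp [sigmaPoint, h0, this, h2]
        field_simp
        ring

/-- The automorphism `f ↦ f ∘ σ⁻¹` of the function field, for `σ : s ↦ (s - 1) / s`. -/
noncomputable def sigmaField (k : Type*) [Field k] : RatFunc k ≃ₐ[k] RatFunc k :=
  AlgEquiv.ofAlgHom (subst (sigmaInvFun k) sigmaInvFun_ne_C) (subst (sigmaFun k) sigmaFun_ne_C)
    (algHom_ext_X (by
      have h0 : (RatFunc.X : RatFunc k) ≠ 0 := RatFunc.X_ne_zero
      have h1 : (1 - RatFunc.X : RatFunc k) ≠ 0 := one_sub_X_ne_zero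
      simp only [AlgHom.comp_apply, subst_X, AlgHom.id_apply]
      rw [sigmaFun, map_div₀, map_sub, map_one, subst_X, sigmaInvFun]
      field_simp
      ring))
    (algHom_ext_X (by
      have h0 : (RatFunc.X : RatFunc k) ≠ 0 := RatFunc.X_ne_zero
      simp only [AlgHom.comp_apply, subst_X, AlgHom.id_apply]
      rw [sigmaInvFun, map_div₀, map_sub, map_one, subst_X, sigmaFun]
      field_simp
      simp))

theorem sigmaField_X : sigmaField k RatFunc.X = sigmaInvFun k := subst_X _ sigmaInvFun_ne_C

theorem sigmaField_pow_three (f : RatFunc k) :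
    sigmaField k (sigmaField k (sigmaField k f)) = f := by
  have h0 : (RatFunc.X : RatFunc k) ≠ 0 := RatFunc.X_ne_zero
  have h1 : (1 - RatFunc.X : RatFunc k) ≠ 0 := one_sub_X_ne_zero
  have h2 : sigmaField k (sigmaInvFun k) = (RatFunc.X - 1) / RatFunc.X := by
    rw [sigmaInvFun, map_div₀, map_sub, map_one, sigmaField_X, sigmaInvFun,
      div_eq_div_iff (by
        rw [sub_ne_zero]; intro h; rw [eq_div_iff h1] at h
        apply h0; linear_combination -h) h0]
    field_simp
    ring
  have : ((sigmaField k).toAlgHom.comp ((sigmaField k).toAlgHom.comp (sigmaField k).toAlgHom)) =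
      AlgHom.id k _ := by
    apply algHom_ext_X
    change sigmaField k (sigmaField k (sigmaField k RatFunc.X)) = RatFunc.X
    rw [sigmaField_X, h2, map_div₀, map_sub, map_one, sigmaField_X, sigmaInvFun]
    field_simp
    ring
  exact congrArg (fun e => e f) this

theorem sigmaField_mem (p : OnePoint L) (f : RatFunc k) (hf : f ∈ localRing k p) :
    ∃ h : sigmaField k f ∈ localRing k (sigmaPoint p),
      evalAt k (sigmaPoint p) ⟨sigmaField k f, h⟩ = evalAt k p ⟨f, hf⟩ := by
  -- it suffices to know the composite with the charts
  have main : ∀ (q : OnePoint L) (_ : sigmaPoint p = q) (g : RatFunc k) (hg : ¬ ∃ c, g = RatFunc.C c)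
      (_ : (chart k q).1 (sigmaField k ((chart k p).1 RatFunc.X)) = g)
      (hx : g ∈ affineRing k (chart k q).2)
      (_ : affineEval k _ ⟨g, hx⟩ = (chart k p).2),
      ∃ h : sigmaField k f ∈ localRing k (sigmaPoint p),
        evalAt k (sigmaPoint p) ⟨sigmaField k f, h⟩ = evalAt k p ⟨f, hf⟩ := by
    rintro q rfl g hg he hx hy
    have e : ∀ f', (chart k (sigmaPoint p)).1 (sigmaField k ((chart k p).1 f')) =
        subst g hg f' := by
      have : (chart k (sigmaPoint p)).1.comp
          ((sigmaField k).toAlgHom.comp (chart k p).1) = subst g hg :=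
        algHom_ext_X (he.trans (subst_X g hg).symm)
      exact fun f' => congrArg (fun e => e f') this
    have e' : (chart k (sigmaPoint p)).1 (sigmaField k f) = subst g hg ((chart k p).1 f) := by
      rw [← e, chart_chart]
    obtain ⟨h, h'⟩ := affineEval_subst (hg := hg) hx hy (f := (chart k p).1 f) hf
    refine ⟨?_, ?_⟩
    · change (chart k (sigmaPoint p)).1 (sigmaField k f) ∈ affineRing k _
      rw [e']; exact h
    · refine Eq.trans ?_ h'
      change affineEval k _ ⟨(chart k (sigmaPoint p)).1 (sigmaField k f), _⟩ = _
      simp only [e']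
  have hX0 : (RatFunc.X : RatFunc k) ≠ 0 := RatFunc.X_ne_zero
  have h1X : (1 - RatFunc.X : RatFunc k) ≠ 0 := one_sub_X_ne_zero
  -- a quotient of two polynomials takes the expected value
  have val : ∀ (x y : L) (a b : k[X]), Polynomial.aeval x b ≠ 0 →
      Polynomial.aeval x a = y * Polynomial.aeval x b →
      ∃ h : algebraMap k[X] (RatFunc k) a / algebraMap k[X] (RatFunc k) b ∈ affineRing k x,
        affineEval k x ⟨_, h⟩ = y := by
    intro x y a b hb hab
    have h1 : ∀ c : k[X], affineEval k x ⟨_, algebraMap_mem_affineRing x c⟩ =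
        Polynomial.aeval x c := fun c => by rw [affineEval_apply]; simp
    obtain ⟨h, h'⟩ := div_mem_affineRing (x := x) ⟨_, algebraMap_mem_affineRing x a⟩
      ⟨_, algebraMap_mem_affineRing x b⟩ (by rw [h1]; exact hb)
    refine ⟨h, h'.trans ?_⟩
    rw [h1, h1, hab, mul_div_cancel_right₀ _ hb]
  have inf : sigmaPoint (∞ : OnePoint L) = ((1 : L) : OnePoint L) := rfl
  have cinf : chart k (∞ : OnePoint L) = (subst RatFunc.X⁻¹ inv_ne_C, 0) := rfl
  have ccoe : ∀ x : L, chart k (x : OnePoint L) = (AlgHom.id k _, x) := fun _ => rfl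
  have hone : (1 : k[X]) - Polynomial.X ≠ 0 := by
    intro h
    have := congrArg (Polynomial.eval 0) h
    simp at this
  induction p using OnePoint.rec with
  | infty =>
    have e1 : algebraMap k[X] (RatFunc k) (1 - Polynomial.X) / algebraMap k[X] (RatFunc k) 1 =
        1 - RatFunc.X := by simp
    obtain ⟨h, h'⟩ := val 1 0 (1 - Polynomial.X) 1 (by simp) (by simp)
    refine main _ inf _ (ne_C_of_mul_eq one_ne_zero rfl ?_) ?_ h h'
    · intro c hc
      have h0 := congrArg (Polynomial.eval 0) hc
      have h1 := congrArg (Polynomial.eval 1) hc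
      simp at h0 h1
      exact one_ne_zero (h0.trans h1.symm)
    · rw [ccoe, cinf, e1]
      change sigmaField k (subst RatFunc.X⁻¹ inv_ne_C RatFunc.X) = _
      rw [subst_X, map_inv₀, sigmaField_X, sigmaInvFun]
      simp
  | coe x =>
    by_cases hx : x = 0
    · subst hx
      have z : sigmaPoint ((0 : L) : OnePoint L) = ∞ := by simp [sigmaPoint]
      have e1 : algebraMap k[X] (RatFunc k) (-Polynomial.X) /
          algebraMap k[X] (RatFunc k) (1 - Polynomial.X) = -RatFunc.X / (1 - RatFunc.X) := by simp
      obtain ⟨h, h'⟩ := val 0 0 (-Polynomial.X) (1 - Polynomial.X) (by simp) (by simp)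
      refine main _ z _ (ne_C_of_mul_eq hone rfl ?_) ?_ h h'
      · intro c hc
        have := congrArg (Polynomial.eval 1) hc
        simp at this
      · rw [ccoe, cinf, e1]
        change subst RatFunc.X⁻¹ inv_ne_C (sigmaField k RatFunc.X) = _
        rw [sigmaField_X, sigmaInvFun, map_div₀, map_sub, map_one, subst_X]
        have : (RatFunc.X - 1 : RatFunc k) ≠ 0 := by
          intro h; apply h1X; linear_combination -h
        field_simp
        ring
    · have z : sigmaPoint (x : OnePoint L) = (((x - 1) / x : L) : OnePoint L) := by
        simp [sigmaPoint, hx]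
      have e1 : algebraMap k[X] (RatFunc k) 1 /
          algebraMap k[X] (RatFunc k) (1 - Polynomial.X) = sigmaInvFun k := by simp [sigmaInvFun]
      have hx1 : 1 - (x - 1) / x = 1 / x := by field_simp; ring
      obtain ⟨h, h'⟩ := val ((x - 1) / x) x 1 (1 - Polynomial.X)
        (by simp only [map_sub, map_one, Polynomial.aeval_X]; rw [hx1]; simpa using hx)
        (by simp only [map_sub, map_one, Polynomial.aeval_X]; rw [hx1]; field_simp)
      refine main _ z _ (ne_C_of_mul_eq hone rfl ?_) ?_ h h'
      · intro c hc
        have := congrArg (Polynomial.eval 1) hc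
        simp at this
      · rw [ccoe, ccoe, e1]
        exact sigmaField_X

theorem compatible_sigma (p : OnePoint L) :
    Compatible (sigmaField k) (AlgHom.id k L) p (sigmaPoint p) := by
  refine ⟨fun f => ⟨fun h => ?_, fun h => (sigmaField_mem p f h).1⟩, fun f hf hf' =>
    (sigmaField_mem p f hf).2⟩
  obtain ⟨h1, _⟩ := sigmaField_mem _ _ h
  obtain ⟨h2, _⟩ := sigmaField_mem _ _ h1
  rwa [sigmaField_pow_three, sigmaPoint_sigmaPoint_sigmaPoint] at h2

theorem sigmaField_phiFun [hk : NeZero (3 : k)] : sigmaField k (phiFun k) = phiFun k := by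
  have h0 : (RatFunc.X : RatFunc k) ≠ 0 := RatFunc.X_ne_zero
  have h1 : (1 - RatFunc.X : RatFunc k) ≠ 0 := one_sub_X_ne_zero
  have h3 : (3 : RatFunc k) ≠ 0 := by
    intro h
    apply hk.out
    apply RatFunc.C_injective (K := k)
    rw [map_ofNat, map_zero]
    exact h
  have hd : (3 * RatFunc.X ^ 2 - 3 * RatFunc.X : RatFunc k) ≠ 0 := by
    intro h
    have : (3 : RatFunc k) * RatFunc.X * (1 - RatFunc.X) = 0 := by linear_combination -h
    simp_all
  have hd' : (3 * sigmaInvFun k ^ 2 - 3 * sigmaInvFun k : RatFunc k) =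
      3 * RatFunc.X / (1 - RatFunc.X) ^ 2 := by
    rw [sigmaInvFun]; field_simp; ring
  rw [phiFun]
  simp only [map_div₀, map_sub, map_add, map_mul, map_pow, map_one, map_ofNat, sigmaField_X]
  rw [hd', div_eq_div_iff (div_ne_zero (mul_ne_zero h3 h0) (pow_ne_zero 2 h1)) hd, sigmaInvFun]
  field_simp
  ring

end Transport

section Minimal

open WeierstrassCurve IsDedekindDomain.HeightOneSpectrum

/-- Minimality in terms of divisibility of discriminants. -/
theorem isMinimal_iff_dvd {R K : Type*} [CommRing R] [IsDomain R] [IsDiscreteValuationRing R]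
    [Field K] [Algebra R K] [IsFractionRing R K] (W : WeierstrassCurve K) :
    IsMinimal R W ↔ IsIntegral R W ∧ ∀ D : VariableChange K, IsIntegral R (D • W) →
      ∃ r : R, (D • W).Δ = algebraMap R K r * W.Δ := by
  have key : ∀ D : VariableChange K, IsIntegral R W → IsIntegral R (D • W) →
      (valuation_Δ_aux R (D • W) ≤ valuation_Δ_aux R W ↔
        ∃ r : R, (D • W).Δ = algebraMap R K r * W.Δ) := by
    intro D hW hD
    rw [← Subtype.coe_le_coe, valuation_Δ_aux_eq_of_isIntegral,
      valuation_Δ_aux_eq_of_isIntegral]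
    constructor
    · intro h
      by_cases h0 : W.Δ = 0
      · exact ⟨0, by rw [variableChange_Δ, h0]; simp⟩
      · have hv : valuation K (IsDiscreteValuationRing.maximalIdeal R) W.Δ ≠ 0 :=
          (Valuation.ne_zero_iff _).mpr h0
        obtain ⟨r, hr⟩ := IsDiscreteValuationRing.exists_lift_of_le_one (A := R)
          (x := (D • W).Δ / W.Δ) (by
            rw [map_div₀]
            exact div_le_one_of_le₀ h (by simp))
        exact ⟨r, by rw [hr, div_mul_cancel₀ _ h0]⟩
    · rintro ⟨r, hr⟩
      rw [hr, map_mul]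
      exact mul_le_of_le_one_left' (valuation_le_one _ r)
  rw [WeierstrassCurve.isMinimal_iff]
  constructor
  · intro h
    have h1 : IsIntegral R W := by simpa using h.1
    refine ⟨h1, fun D hD => (key D h1 hD).mp ?_⟩
    rcases le_total (valuation_Δ_aux R (D • W)) (valuation_Δ_aux R W) with h' | h'
    · exact h'
    · simpa using h.2 hD (by simpa using h')
  · rintro ⟨h1, h2⟩
    refine ⟨by simpa using h1, fun D hD _ => ?_⟩
    simpa using (key D h1 hD).mpr (h2 D hD)

end Minimal

section Model

open WeierstrassCurve

variable {k : Type*} [Field k] {L : Type*} [Field L] [Algebra k L] [Algebra.IsAlgebraic k L]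

theorem map_mul_change {A B : Type*} [CommRing A] [CommRing B] (f : A →+* B)
    (C D : VariableChange A) : (C * D).map f = C.map f * D.map f :=
  (VariableChange.mapHom f).map_mul C D

theorem map_one_change {A B : Type*} [CommRing A] [CommRing B] (f : A →+* B) :
    (1 : VariableChange A).map f = 1 :=
  (VariableChange.mapHom f).map_one

/-- The Weierstrass curve over `L` at the point `p`, obtained by evaluating the coefficients of a
Weierstrass equation which is minimal at `p`. -/
noncomputable def reducedCurve (V : WeierstrassCurve (RatFunc k)) (p : OnePoint L)
    [IsMinimal (localRing k p) V] : WeierstrassCurve L :=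
  (integralModel (localRing k p) V).map (evalAt k p)

/-- The change of coordinates `(x, y) ↦ (u²x + r, u³y + u²sx + t)` on the points of a projective
Weierstrass curve, where `none` is the unique point `[0 : 1 : 0]` on the line at infinity. -/
def changeCoord (D : VariableChange L) : Option (L × L) → Option (L × L) :=
  Option.map fun P => (D.u ^ 2 * P.1 + D.r, D.u ^ 3 * P.2 + D.u ^ 2 * D.s * P.1 + D.t)

/-- An `L`-valued point, over `p`, of a local piece of the Weierstrass model of `W`: a Weierstrass
equation for `W` which is minimal at `p`, and a (possibly singular) point on the projective cubic
curve over `L` that it defines at `p`. Here `some (x, y)` is the affine point `[x : y : 1]`,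
and `none` is the point `[0 : 1 : 0]`. -/
structure LocalPoint (W : WeierstrassCurve (RatFunc k)) (p : OnePoint L) where
  change : VariableChange (RatFunc k)
  [minimal : IsMinimal (localRing k p) (change • W)]
  point : Option (L × L)
  equation : ∀ P ∈ point, (reducedCurve (change • W) p).toAffine.Equation P.1 P.2

attribute [instance] LocalPoint.minimal

/-- The local pieces are glued along the changes of coordinates that are defined at `p`. -/
instance localPointSetoid (W : WeierstrassCurve (RatFunc k)) (p : OnePoint L) :
    Setoid (LocalPoint W p) where
  r P Q := ∃ D : VariableChange (localRing k p),
    Q.change = D.map (localRing k p).subtype * P.change ∧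
      P.point = changeCoord (D.map (evalAt k p)) Q.point
  iseqv := by
    have one : ∀ P, changeCoord (1 : VariableChange L) P = P := by
      rintro (_ | P) <;> simp [changeCoord, VariableChange.one_def]
    have mul : ∀ (C D : VariableChange L) P,
        changeCoord (C * D) P = changeCoord D (changeCoord C P) := by
      rintro C D (_ | P)
      · rfl
      · simp only [changeCoord, VariableChange.mul_def, Option.map_some, Units.val_mul,
          Option.some.injEq, Prod.mk.injEq]
        constructor <;> ring
    refine ⟨fun P => ⟨1, ?_, ?_⟩, ?_, ?_⟩
    · rw [map_one_change, one_mul]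
    · rw [map_one_change, one]
    · rintro P Q ⟨D, h, h'⟩
      refine ⟨D⁻¹, ?_, ?_⟩
      · rw [h, ← mul_assoc, ← map_mul_change, inv_mul_cancel, map_one_change, one_mul]
      · rw [h', ← mul, ← map_mul_change, mul_inv_cancel, map_one_change, one]
    · rintro P Q S ⟨D, h, h'⟩ ⟨E, g, g'⟩
      refine ⟨E * D, ?_, ?_⟩
      · rw [g, h, map_mul_change, mul_assoc]
      · rw [h', g', map_mul_change, mul]

/-- The set of `L`-valued points of the fibre above `p` of the Weierstrass model, over the
projective line over `k`, of the elliptic curve `W` over `k(X)`. -/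
def Fibre (W : WeierstrassCurve (RatFunc k)) (p : OnePoint L) : Type _ :=
  Quotient (localPointSetoid W p)

/-- The set of `L`-valued points of the Weierstrass model of `W`. -/
def WeierstrassModel (W : WeierstrassCurve (RatFunc k)) (L : Type*) [Field L] [Algebra k L]
    [Algebra.IsAlgebraic k L] : Type _ :=
  Σ p : OnePoint L, Fibre W p

end Model

section Functoriality

open WeierstrassCurve

variable {k : Type*} [Field k] {L : Type*} [Field L] [Algebra k L] [Algebra.IsAlgebraic k L]
  {L' : Type*} [Field L'] [Algebra k L'] [Algebra.IsAlgebraic k L']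
  {e : RatFunc k ≃ₐ[k] RatFunc k} {τ : L →ₐ[k] L'} {p : OnePoint L} {q : OnePoint L'}

theorem isIntegral_iff_mem (V : WeierstrassCurve (RatFunc k)) :
    IsIntegral (localRing k p) V ↔ V.a₁ ∈ localRing k p ∧ V.a₂ ∈ localRing k p ∧
      V.a₃ ∈ localRing k p ∧ V.a₄ ∈ localRing k p ∧ V.a₆ ∈ localRing k p := by
  constructor
  · intro h
    exact ⟨integralModel_a₁_eq (localRing k p) V ▸ Subtype.mem _,
      integralModel_a₂_eq (localRing k p) V ▸ Subtype.mem _,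
      integralModel_a₃_eq (localRing k p) V ▸ Subtype.mem _,
      integralModel_a₄_eq (localRing k p) V ▸ Subtype.mem _,
      integralModel_a₆_eq (localRing k p) V ▸ Subtype.mem _⟩
  · rintro ⟨h1, h2, h3, h4, h6⟩
    exact isIntegral_of_exists_lift _ ⟨⟨_, h1⟩, rfl⟩ ⟨⟨_, h2⟩, rfl⟩ ⟨⟨_, h3⟩, rfl⟩ ⟨⟨_, h4⟩, rfl⟩
      ⟨⟨_, h6⟩, rfl⟩

theorem Compatible.isIntegral_iff (h : Compatible e τ p q) (V : WeierstrassCurve (RatFunc k)) :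
    IsIntegral (localRing k q) (V.map (e : RatFunc k →+* RatFunc k)) ↔
      IsIntegral (localRing k p) V := by
  rw [isIntegral_iff_mem, isIntegral_iff_mem]
  simpa using and_congr (h.mem_iff _) (and_congr (h.mem_iff _) (and_congr (h.mem_iff _)
    (and_congr (h.mem_iff _) (h.mem_iff _))))

theorem Compatible.isMinimal (h : Compatible e τ p q) (V : WeierstrassCurve (RatFunc k))
    (hV : IsMinimal (localRing k p) V) :
    IsMinimal (localRing k q) (V.map (e : RatFunc k →+* RatFunc k)) := by
  rw [isMinimal_iff_dvd] at hV ⊢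
  refine ⟨(h.isIntegral_iff V).mpr hV.1, fun D hD => ?_⟩
  have hD' : D = (D.map (e.symm : RatFunc k →+* RatFunc k)).map
      (e : RatFunc k →+* RatFunc k) := by
    ext <;> simp
  rw [hD', map_variableChange] at hD ⊢
  obtain ⟨r, hr⟩ := hV.2 _ ((h.isIntegral_iff _).mp hD)
  refine ⟨⟨e r, (h.mem_iff _).mpr r.2⟩, ?_⟩
  rw [map_Δ, map_Δ, hr, map_mul]
  rfl

theorem Compatible.reducedCurve_map (h : Compatible e τ p q) (V : WeierstrassCurve (RatFunc k))
    [hV : IsMinimal (localRing k p) V]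
    [hV' : IsMinimal (localRing k q) (V.map (e : RatFunc k →+* RatFunc k))] :
    reducedCurve (V.map (e : RatFunc k →+* RatFunc k)) q =
      (reducedCurve V p).map (τ : L →+* L') := by
  have key : ∀ (a : localRing k p) (b : localRing k q), (b : RatFunc k) = e a →
      evalAt k q b = τ (evalAt k p a) := by
    rintro ⟨a, ha⟩ ⟨b, hb⟩ rfl
    exact h.eval_eq a ha hb
  ext
  · exact key _ _ ((integralModel_a₁_eq (localRing k q) (V.map _)).trans
      (congrArg e (integralModel_a₁_eq (localRing k p) V).symm))
  · exact key _ _ ((integralModel_a₂_eq (localRing k q) (V.map _)).trans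
      (congrArg e (integralModel_a₂_eq (localRing k p) V).symm))
  · exact key _ _ ((integralModel_a₃_eq (localRing k q) (V.map _)).trans
      (congrArg e (integralModel_a₃_eq (localRing k p) V).symm))
  · exact key _ _ ((integralModel_a₄_eq (localRing k q) (V.map _)).trans
      (congrArg e (integralModel_a₄_eq (localRing k p) V).symm))
  · exact key _ _ ((integralModel_a₆_eq (localRing k q) (V.map _)).trans
      (congrArg e (integralModel_a₆_eq (localRing k p) V).symm))

/-- Transport of structure: `e` is applied to the equation and `τ` to the coordinates. -/
noncomputable def LocalPoint.transport {W : WeierstrassCurve (RatFunc k)} (h : Compatible e τ p q)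
    (hW : W.map (e : RatFunc k →+* RatFunc k) = W) (P : LocalPoint W p) : LocalPoint W q :=
  have hC : (P.change • W).map (e : RatFunc k →+* RatFunc k) =
      P.change.map (e : RatFunc k →+* RatFunc k) • W := by
    rw [← map_variableChange, hW]
  haveI : IsMinimal (localRing k q) (P.change.map (e : RatFunc k →+* RatFunc k) • W) :=
    hC ▸ h.isMinimal _ P.minimal
  { change := P.change.map (e : RatFunc k →+* RatFunc k)
    point := P.point.map fun P => (τ P.1, τ P.2)
    equation := by
      have hr : reducedCurve (P.change.map (e : RatFunc k →+* RatFunc k) • W) q =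
          (reducedCurve (P.change • W) p).map (τ : L →+* L') := by
        have := h.isMinimal _ P.minimal
        rw [← h.reducedCurve_map]
        simp only [hC]
      intro Q hQ
      obtain ⟨R, hR, rfl⟩ := Option.mem_map.mp hQ
      rw [hr]
      exact (P.equation R hR).map (τ : L →+* L') }

/-- The map on fibres induced by transport of structure. -/
noncomputable def Fibre.transport {W : WeierstrassCurve (RatFunc k)} (h : Compatible e τ p q)
    (hW : W.map (e : RatFunc k →+* RatFunc k) = W) : Fibre W p → Fibre W q :=
  Quotient.map (LocalPoint.transport h hW) (by
    rintro P Q ⟨D, hD, hD'⟩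
    let E : localRing k p →+* localRing k q :=
      (e : RatFunc k →+* RatFunc k).restrict _ _ fun f hf => (h.mem_iff f).mpr hf
    refine ⟨D.map E, ?_, ?_⟩
    · change Q.change.map _ = _ * P.change.map _
      rw [hD, map_mul_change]
      rfl
    · have hE : ∀ a, evalAt k q (E a) = τ (evalAt k p a) := fun a =>
        h.eval_eq a a.2 ((h.mem_iff _).mpr a.2)
      change P.point.map _ = changeCoord _ (Q.point.map _)
      rw [hD']
      cases Q.point with
      | none => rfl
      | some R => simp [changeCoord, VariableChange.map, hE])

end Functoriality

section BaseChange

open WeierstrassCurve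

variable {k : Type*} [Field k]

/-- The generic fibre of the base change of the elliptic surface with generic fibre `W` over the
cover `t = φ(s) = (s³ - 3s² + 1) / (3s² - 3s)` of the projective line: the coefficients `aᵢ(t)` are
replaced by `aᵢ(φ(s))`. -/
noncomputable def cubicBaseChange [NeZero (3 : k)] (W : WeierstrassCurve (RatFunc k)) :
    WeierstrassCurve (RatFunc k) :=
  W.map (subst (phiFun k) phiFun_ne_C : RatFunc k →+* RatFunc k)

theorem cubicBaseChange_sigma [NeZero (3 : k)] (W : WeierstrassCurve (RatFunc k)) :
    (cubicBaseChange W).map (sigmaField k : RatFunc k →+* RatFunc k) = cubicBaseChange W := by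
  have : (sigmaField k).toAlgHom.comp (subst (phiFun k) phiFun_ne_C) =
      subst (phiFun k) phiFun_ne_C := by
    apply algHom_ext_X
    change sigmaField k (subst (phiFun k) phiFun_ne_C RatFunc.X) = _
    rw [subst_X, sigmaField_phiFun]
  have h : ∀ f, sigmaField k (subst (phiFun k) phiFun_ne_C f) = subst (phiFun k) phiFun_ne_C f :=
    fun f => congrArg (fun e => e f) this
  ext <;> exact h _

/-- The automorphism of the Weierstrass model of the base change that is induced by
`σ : s ↦ (s - 1) / s`, that is, `(x, y, s) ↦ (x, y, σ(s))` in the coordinates of `W`. -/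
noncomputable def sigma [NeZero (3 : k)] (W : WeierstrassCurve (RatFunc k)) {L : Type*} [Field L]
    [Algebra k L] [Algebra.IsAlgebraic k L] :
    WeierstrassModel (cubicBaseChange W) L → WeierstrassModel (cubicBaseChange W) L :=
  fun P => ⟨sigmaPoint P.1,
    P.2.transport (compatible_sigma P.1) (cubicBaseChange_sigma W)⟩

/-- The Frobenius map of a Weierstrass model over the finite field `k`, raising coordinates to the
power `q = #k`. -/
noncomputable def frobenius [Fintype k] (W : WeierstrassCurve (RatFunc k)) {L : Type*} [Field L]
    [Algebra k L] [Algebra.IsAlgebraic k L] : WeierstrassModel W L → WeierstrassModel W L :=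
  fun P => ⟨P.1.map (FiniteField.frobeniusAlgHom k L),
    P.2.transport (compatible_map (FiniteField.frobeniusAlgHom k L) P.1) W.map_id⟩

/-- The map `Fr_q^{(i)} = Fr_q ∘ σ^i` on the geometric points of the Weierstrass model of the base
change. -/
noncomputable def twistedFrobenius [Fintype k] [NeZero (3 : k)] (W : WeierstrassCurve (RatFunc k))
    (i : Fin 3) (P : WeierstrassModel (cubicBaseChange W) (AlgebraicClosure k)) :
    WeierstrassModel (cubicBaseChange W) (AlgebraicClosure k) :=
  frobenius (cubicBaseChange W) ((sigma W)^[i] P)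

/-- The cubic polynomial `x³ - 3(t + 1)x² + 3tx + 1`. -/
noncomputable def fibreCubic (t : k) : k[X] :=
  Polynomial.X ^ 3 - Polynomial.C (3 * (t + 1)) * Polynomial.X ^ 2 +
    Polynomial.C (3 * t) * Polynomial.X + 1

/-- The points `t` whose fibre cubic divides `x^q - x`, together with `∞`. -/
def K0 (k : Type*) [Field k] [Fintype k] : Set (OnePoint k) :=
  (↑) '' {t : k | fibreCubic t ∣ Polynomial.X ^ Fintype.card k - Polynomial.X} ∪ {∞}

/-- The points `t` whose fibre cubic divides `x^(q+1) - x + 1`. -/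
def K2 (k : Type*) [Field k] [Fintype k] : Set (OnePoint k) :=
  (↑) '' {t : k | fibreCubic t ∣ Polynomial.X ^ (Fintype.card k + 1) - Polynomial.X + 1}

/-- The remaining finite points `t`, except for the branch points `ζ` and `ζ²`, where `ζ` is a
primitive third root of unity. -/
def K1 (k : Type*) [Field k] [Fintype k] (ζ : AlgebraicClosure k) : Set (OnePoint k) :=
  (((↑) '' (Set.univ : Set k) \ K0 k) \ K2 k) \
    (↑) '' {t : k | algebraMap k (AlgebraicClosure k) t ∈ ({ζ, ζ ^ 2} : Set (AlgebraicClosure k))}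

/-- The sets `K^{(i)}`. -/
def K (k : Type*) [Field k] [Fintype k] (ζ : AlgebraicClosure k) : Fin 3 → Set (OnePoint k) :=
  ![K0 k, K1 k ζ, K2 k]

end BaseChange

end EllipticSurface

/-!
A point `s` of the projective line is fixed by `Fr_q ∘ σ ^ i` only if `t = φ(s)` is rational over
`k`, because `φ` is invariant under `σ` and defined over `k`. The fibres of `φ` are the orbits of
`σ`, and away from the ramification points `-ζ`, `-ζ²` such an orbit has three elements, which are
the roots of the cubic polynomial of `t` (or `0`, `1`, `∞`). Since Frobenius commutes with `σ`, it
acts on the orbit as a power of `σ`, and the set `K^{(i)}` that contains `t` records which power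
(`mem_K_iff`). So the unramified fixed points of the base are the points above `K^{(i)}`, three
above each of them.

It remains to count the fixed points in the fibre above an unramified fixed point `s`. The main
input is that an equation of `W` that is minimal at `t` stays minimal at `s` when it is pulled back
(`isMinimal_cubicBaseChange`). In the coordinates of the pulled back equation, which is invariant
under `σ`, the map is `(x, y) ↦ (x ^ q, y ^ q)`, so that its fixed points are the `k`-rational
points of the fibre of `W` above `t` (`fixed_iff_exists_hasCoords`).

Stability of minimality under unramified extensions `R ⊆ S` of discrete valuation rings
(`IsUnramifiedAt.isMinimal_map`) is reduced to the following: if a translation over `S` makes `aᵢ`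
divisible by `π ^ i` for all `i`, then so does a translation over `R`. If `2` is invertible, one
completes the square and the cube. In characteristic two, the translation can be found
successively modulo powers of `π`, as the residue field of `R` is perfect and square roots are
unique. That `3` is a unit also makes the coordinates on a fibre well defined: any two minimal
equations then differ by an integral change of variables (`exists_lift_change`).

In an arbitrary fibre, the fixed points satisfy `x ^ q = u² x + r` and a similar equation for `y`,
which gives the finiteness of the set of all fixed points.
-/

namespace EllipticSurface

/-! ### Descent of non-minimality along an unramified extension -/

section Descent

open WeierstrassCurve

/-- The coefficient `aᵢ` of `W` is divisible by `π ^ i` for all `i`: the equation of `W` is not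
minimal at `π`, as it can be rescaled by `u = π`. -/
def IsRescalable {R : Type*} [CommRing R] (π : R) (W : WeierstrassCurve R) : Prop :=
  π ∣ W.a₁ ∧ π ^ 2 ∣ W.a₂ ∧ π ^ 3 ∣ W.a₃ ∧ π ^ 4 ∣ W.a₄ ∧ π ^ 6 ∣ W.a₆

theorem IsRescalable.of_translate {R : Type*} [CommRing R] {π r s t : R}
    {W : WeierstrassCurve R}
    (h : IsRescalable π
      ((⟨1, π ^ 2 * r, π * s, π ^ 3 * t⟩ : VariableChange R) • W)) : IsRescalable π W := by
  obtain ⟨⟨c1, h1⟩, ⟨c2, h2⟩, ⟨c3, h3⟩, ⟨c4, h4⟩, ⟨c6, h6⟩⟩ := h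
  simp only [variableChange_def, inv_one, Units.val_one, one_pow, one_mul] at h1 h2 h3 h4 h6
  have e1 : π ∣ W.a₁ := ⟨c1 - 2 * s, by linear_combination h1⟩
  obtain ⟨b1, g1⟩ := e1
  have e2 : π ^ 2 ∣ W.a₂ := ⟨c2 + s * b1 - 3 * r + s ^ 2, by
    linear_combination h2 + π * s * g1⟩
  obtain ⟨b2, g2⟩ := e2
  have e3 : π ^ 3 ∣ W.a₃ := ⟨c3 - r * b1 - 2 * t, by
    linear_combination h3 - π ^ 2 * r * g1⟩
  obtain ⟨b3, g3⟩ := e3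
  have e4 : π ^ 4 ∣ W.a₄ := ⟨c4 + s * b3 - 2 * r * b2 + (t + r * s) * b1 - 3 * r ^ 2 +
      2 * s * t, by
    linear_combination h4 + π * s * g3 - 2 * π ^ 2 * r * g2 +
      (π ^ 3 * t + π ^ 2 * r * (π * s)) * g1⟩
  obtain ⟨b4, g4⟩ := e4
  refine ⟨⟨b1, g1⟩, ⟨b2, g2⟩, ⟨b3, g3⟩, ⟨b4, g4⟩,
    ⟨c6 - r * b4 - r ^ 2 * b2 - r ^ 3 + t * b3 + t ^ 2 + r * t * b1, ?_⟩⟩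
  linear_combination h6 - π ^ 2 * r * g4 - π ^ 4 * r ^ 2 * g2 + π ^ 3 * t * g3 +
    π ^ 2 * r * (π ^ 3 * t) * g1

/-- The ring homomorphism `f : R → S` behaves like an unramified extension of discrete valuation
rings with residue maps `vR : R → F` and `vS : S → L`: the uniformizer `π` of `R` is also a
uniformizer of `S`. -/
structure IsUnramifiedAt {R S F L : Type*} [CommRing R] [CommRing S] [Field F] [Field L]
    (f : R →+* S) (vR : R →+* F) (vS : S →+* L) (j : F →+* L) (π : R) : Prop where
  surjective : Function.Surjective vR
  comp_eq : ∀ x, vS (f x) = j (vR x)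
  map_pi : vR π = 0
  dvd : ∀ x, vR x = 0 → π ∣ x
  dvd_map : ∀ y, vS y = 0 → f π ∣ y
  ne_zero : f π ≠ 0

variable {R S F L : Type*} [CommRing R] [CommRing S] [Field F] [Field L]
  {f : R →+* S} {vR : R →+* F} {vS : S →+* L} {j : F →+* L} {π : R}

theorem IsUnramifiedAt.residue_map_pi (H : IsUnramifiedAt f vR vS j π) : vS (f π) = 0 := by
  rw [H.comp_eq, H.map_pi, map_zero]

theorem IsUnramifiedAt.pow_dvd [IsDomain S] (H : IsUnramifiedAt f vR vS j π) (n : ℕ) :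
    ∀ x, f π ^ n ∣ f x → π ^ n ∣ x := by
  induction n with
  | zero => simp
  | succ n ih =>
    rintro x ⟨c, hc⟩
    have h0 : vR x = 0 := by
      apply j.injective
      rw [← H.comp_eq, hc, map_mul, map_pow, H.residue_map_pi, map_zero]
      simp
    obtain ⟨y, rfl⟩ := H.dvd x h0
    rw [pow_succ']
    refine mul_dvd_mul_left _ (ih y ⟨c, mul_left_cancel₀ H.ne_zero ?_⟩)
    rw [← map_mul, hc]
    ring

theorem IsUnramifiedAt.isRescalable [IsDomain S] (H : IsUnramifiedAt f vR vS j π)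
    {W : WeierstrassCurve R}    (h : IsRescalable (f π) (W.map f)) : IsRescalable π W := by
  obtain ⟨h1, h2, h3, h4, h6⟩ := h
  exact ⟨by simpa using H.pow_dvd 1 _ (by simpa using h1), H.pow_dvd _ _ h2, H.pow_dvd _ _ h3,
    H.pow_dvd _ _ h4, H.pow_dvd _ _ h6⟩

/-- In characteristic two, an element of `S` whose square is congruent to an element of `R` is
itself congruent to an element of `R`: the residue field of `R` is perfect and square roots are
unique. -/
theorem IsUnramifiedAt.exists_sqrt (H : IsUnramifiedAt f vR vS j π) (h2 : (2 : R) = 0)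
    (hF : ∀ c : F, ∃ d, d ^ 2 = c) {c : R} {t : S} (h : vS (f c - t ^ 2) = 0) :
    ∃ t₀ t', t = f t₀ + f π * t' := by
  obtain ⟨d, hd⟩ := hF (vR c)
  obtain ⟨t₀, rfl⟩ := H.surjective d
  have h2L : (2 : L) = 0 := by
    rw [← map_ofNat vS 2, ← map_ofNat f 2, h2, map_zero, map_zero]
  have : (vS (t - f t₀)) ^ 2 = 0 := by
    rw [map_sub, map_pow, H.comp_eq, ← hd, map_pow] at h
    rw [map_sub, H.comp_eq]
    linear_combination -h + (j (vR t₀) ^ 2 - vS t * j (vR t₀)) * h2L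
  obtain ⟨t', ht'⟩ := H.dvd_map _ (pow_eq_zero_iff two_ne_zero |>.mp this)
  exact ⟨t₀, t', by linear_combination ht'⟩

theorem map_translate (f : R →+* S) (r s t : R) :
    (⟨1, r, s, t⟩ : VariableChange R).map f = ⟨1, f r, f s, f t⟩ := by
  ext <;> simp

theorem translate_translate (r s t r' s' t' : R) (W : WeierstrassCurve R) :
    (⟨1, r, s, t⟩ : VariableChange R) • (⟨1, r', s', t'⟩ : VariableChange R) • W =
      (⟨1, r + r', s + s', t + r * s' + t'⟩ : VariableChange R) • W := by
  rw [← mul_smul, VariableChange.mul_def]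
  simp

theorem exists_translate_of_translate (r₀ s₀ t₀ : R) {W : WeierstrassCurve R}
    (h : ∃ r s t : R, IsRescalable π
      ((⟨1, r, s, t⟩ : VariableChange R) • (⟨1, r₀, s₀, t₀⟩ : VariableChange R) • W)) :
    ∃ r s t : R, IsRescalable π ((⟨1, r, s, t⟩ : VariableChange R) • W) := by
  obtain ⟨r, s, t, h⟩ := h
  rw [translate_translate] at h
  exact ⟨_, _, _, h⟩

/-- A translation over `S` is split into a translation `(r', s', t')` over `S` and a translation
`(r₀, s₀, t₀)` over `R`. -/
theorem isRescalable_translate (r₀ s₀ t₀ : R) {W : WeierstrassCurve R} {r s t r' s' t' : S} {p : S}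
    (h : IsRescalable p ((⟨1, r, s, t⟩ : VariableChange S) • W.map f))
    (hr : r = r' + f r₀) (hs : s = s' + f s₀) (ht : t = t' + r' * f s₀ + f t₀) :
    IsRescalable p ((⟨1, r', s', t'⟩ : VariableChange S) •
      ((⟨1, r₀, s₀, t₀⟩ : VariableChange R) • W).map f) := by
  rw [← map_variableChange, map_translate, translate_translate, ← hr, ← hs, ← ht]
  exact h

/-- When `2` is a unit, an equation over `R` that becomes rescalable after a translation over `S`
does so after a translation over `R`, namely the one that gives `y² = x³ + a₄x + a₆`. -/
theorem IsUnramifiedAt.descend_of_isUnit_two [IsDomain S] (H : IsUnramifiedAt f vR vS j π)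
    (h2 : IsUnit (2 : R)) (h3 : IsUnit (3 : R)) {W : WeierstrassCurve R} {r s t : S}
    (h : IsRescalable (f π) ((⟨1, r, s, t⟩ : VariableChange S) • W.map f)) :
    ∃ r s t : R, IsRescalable π ((⟨1, r, s, t⟩ : VariableChange R) • W) := by
  obtain ⟨i2, hi2⟩ := h2.exists_left_inv
  obtain ⟨i3, hi3⟩ := h3.exists_left_inv
  -- completing the square and the cube leaves an equation `y² = x³ + a₄x + a₆`
  let s₀ : R := -i2 * W.a₁
  let r₀ : R := i3 * (s₀ ^ 2 + s₀ * W.a₁ - W.a₂)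
  let t₀ : R := -i2 * (W.a₃ + r₀ * W.a₁)
  apply exists_translate_of_translate r₀ s₀ t₀
  replace h := isRescalable_translate r₀ s₀ t₀ h (r' := r - f r₀) (s' := s - f s₀)
    (t' := t - f t₀ - (r - f r₀) * f s₀) (by ring) (by ring) (by ring)
  generalize r - f r₀ = r' at h
  generalize s - f s₀ = s' at h
  generalize t - f t₀ - r' * f s₀ = t' at h
  have a1 : ((⟨1, r₀, s₀, t₀⟩ : VariableChange R) • W).a₁ = 0 := by
    simp only [variableChange_def, inv_one, Units.val_one, one_pow, one_mul]
    linear_combination -W.a₁ * hi2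
  have a2 : ((⟨1, r₀, s₀, t₀⟩ : VariableChange R) • W).a₂ = 0 := by
    simp only [variableChange_def, inv_one, Units.val_one, one_pow, one_mul]
    linear_combination (s₀ ^ 2 + s₀ * W.a₁ - W.a₂) * hi3
  have a3 : ((⟨1, r₀, s₀, t₀⟩ : VariableChange R) • W).a₃ = 0 := by
    simp only [variableChange_def, inv_one, Units.val_one, one_pow, one_mul]
    linear_combination -(W.a₃ + r₀ * W.a₁) * hi2
  refine ⟨0, 0, 0, ?_⟩
  change IsRescalable π ((1 : VariableChange R) • _)
  rw [one_smul]
  apply H.isRescalable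
  generalize (⟨1, r₀, s₀, t₀⟩ : VariableChange R) • W = V at *
  have hi2S : f i2 * 2 = 1 := by rw [← map_ofNat f 2, ← map_mul, hi2, map_one]
  have hi3S : f i3 * 3 = 1 := by rw [← map_ofNat f 3, ← map_mul, hi3, map_one]
  obtain ⟨⟨c1, h1⟩, ⟨c2, h2⟩, ⟨c3, h3⟩, h4, h6⟩ := h
  simp only [variableChange_def, inv_one, Units.val_one, one_pow, one_mul, map_a₁, map_a₂, map_a₃,
    map_a₄, map_a₆, a1, a2, a3, map_zero] at h1 h2 h3 h4 h6
  have es : s' = f π * (f i2 * c1) := by linear_combination f i2 * h1 - s' * hi2S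
  have er : r' = f π ^ 2 * (f i3 * (c2 + (f i2 * c1) ^ 2)) := by
    rw [es] at h2
    linear_combination f i3 * h2 - r' * hi3S
  have et : t' = f π ^ 3 * (f i2 * c3) := by linear_combination f i2 * h3 - t' * hi2S
  refine IsRescalable.of_translate (r := f i3 * (c2 + (f i2 * c1) ^ 2)) (s := f i2 * c1)
    (t := f i2 * c3) ?_
  rw [← es, ← er, ← et]
  simp only [IsRescalable, variableChange_def, inv_one, Units.val_one, one_pow, one_mul, map_a₁,
    map_a₂, map_a₃, map_a₄, map_a₆, a1, a2, a3, map_zero]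
  exact ⟨⟨c1, h1⟩, ⟨c2, h2⟩, ⟨c3, h3⟩, h4, h6⟩

/-- The same in characteristic two: the translation over `S` is approximated step by step by
translations over `R`. At each step the next coefficient is determined by its square modulo `π`, or
is given by the equation. -/
theorem IsUnramifiedAt.descend_of_two_eq_zero [IsDomain S] (H : IsUnramifiedAt f vR vS j π)
    (h2' : (2 : R) = 0) (hF : ∀ c : F, ∃ d, d ^ 2 = c) {W : WeierstrassCurve R} {r s t : S}
    (h : IsRescalable (f π) ((⟨1, r, s, t⟩ : VariableChange S) • W.map f)) :
    ∃ r s t : R, IsRescalable π ((⟨1, r, s, t⟩ : VariableChange R) • W) := by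
  have two : (2 : S) = 0 := by rw [← map_ofNat f 2, h2', map_zero]
  have hπ := H.residue_map_pi
  -- the conditions on the translated equation, with signs dropped and multiples of `2` removed
  have expand : ∀ {V : WeierstrassCurve R} {r s t : S},
      IsRescalable (f π) ((⟨1, r, s, t⟩ : VariableChange S) • V.map f) →
      (∃ c, f V.a₁ = f π * c) ∧ (∃ c, f V.a₂ = f π ^ 2 * c + s * f V.a₁ + r + s ^ 2) ∧
      (∃ c, f V.a₃ = f π ^ 3 * c + r * f V.a₁) ∧
      (∃ c, f V.a₄ = f π ^ 4 * c + s * f V.a₃ + (t + r * s) * f V.a₁ + r ^ 2) ∧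
      (∃ c, f V.a₆ = f π ^ 6 * c + r * f V.a₄ + r ^ 2 * f V.a₂ + r ^ 3 + t * f V.a₃ + t ^ 2 +
        r * t * f V.a₁) := by
    rintro V r s t ⟨⟨c1, h1⟩, ⟨c2, h2⟩, ⟨c3, h3⟩, ⟨c4, h4⟩, ⟨c6, h6⟩⟩
    simp only [variableChange_def, inv_one, Units.val_one, one_pow, one_mul, map_a₁, map_a₂,
      map_a₃, map_a₄, map_a₆] at h1 h2 h3 h4 h6
    exact ⟨⟨c1, by linear_combination h1 - s * two⟩, ⟨c2, by linear_combination h2 - 2 * r * two⟩,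
      ⟨c3, by linear_combination h3 - (t + r * f V.a₁) * two⟩,
      ⟨c4, by linear_combination h4 + (s * t - r * f V.a₂ - 2 * r ^ 2) * two⟩,
      ⟨c6, by linear_combination h6 - (r * f V.a₄ + r ^ 2 * f V.a₂ + r ^ 3) * two⟩⟩
  -- `t` modulo `π³` is read off from `a₆` modulo `π⁵`
  have step3 : ∀ (V : WeierstrassCurve R) (r s t : S),
      IsRescalable (f π)
        ((⟨1, f π ^ 2 * r, f π * s, f π ^ 2 * t⟩ : VariableChange S) • V.map f) →
      ∃ r s t : R, IsRescalable π ((⟨1, r, s, t⟩ : VariableChange R) • V) := by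
    intro V r s t h
    obtain ⟨⟨c1, h1⟩, ⟨c2, h2⟩, ⟨c3, h3⟩, ⟨c4, h4⟩, ⟨c6, h6⟩⟩ := expand h
    rw [h1] at h2 h3 h4 h6
    rw [h2] at h6
    rw [h3] at h4 h6
    rw [h4] at h6
    have e6 : f V.a₆ = f π ^ 4 * (t ^ 2 + f π * (3 * r * c1 * t + c3 * t + f π * (c6 + r * c4 +
        r * s * c3 + 3 * r ^ 2 * s * c1 + r ^ 2 * s ^ 2 + r ^ 2 * c2 + 3 * r ^ 3))) := by
      rw [h6]; ring
    obtain ⟨c, hc⟩ : π ^ 4 ∣ V.a₆ := H.pow_dvd 4 _ (Dvd.intro _ e6.symm)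
    rw [hc, map_mul, map_pow] at e6
    obtain ⟨t₀, t', rfl⟩ := H.exists_sqrt h2' hF (c := c) (t := t) (by
      rw [mul_left_cancel₀ (pow_ne_zero 4 H.ne_zero) e6, add_sub_cancel_left, map_mul, hπ,
        zero_mul])
    refine exists_translate_of_translate 0 0 (π ^ 2 * t₀) ⟨0, 0, 0, ?_⟩
    change IsRescalable π ((1 : VariableChange R) • _)
    rw [one_smul]
    refine H.isRescalable (IsRescalable.of_translate (r := r) (s := s) (t := t') ?_)
    exact isRescalable_translate _ _ _ h (by simp) (by simp) (by
      simp only [map_mul, map_pow, map_zero]; ring)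
  -- `t` modulo `π²` is read off from `a₆` modulo `π³`
  have step2 : ∀ (V : WeierstrassCurve R) (r s t : S),
      IsRescalable (f π)
        ((⟨1, f π ^ 2 * r, f π * s, f π * t⟩ : VariableChange S) • V.map f) →
      ∃ r s t : R, IsRescalable π ((⟨1, r, s, t⟩ : VariableChange R) • V) := by
    intro V r s t h
    obtain ⟨⟨c1, h1⟩, ⟨c2, h2⟩, ⟨c3, h3⟩, ⟨c4, h4⟩, ⟨c6, h6⟩⟩ := expand h
    rw [h1] at h2 h3 h4 h6
    rw [h2] at h6
    rw [h3] at h4 h6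
    rw [h4] at h6
    have e6 : f V.a₆ = f π ^ 2 * (t ^ 2 + f π * (f π ^ 3 * c6 + f π ^ 3 * r * c4 +
        f π ^ 3 * r * s * (c3 + r * c1) + f π * r * (t + f π ^ 2 * r * s) * c1 + f π ^ 3 * r ^ 3 +
        f π ^ 3 * r ^ 2 * (c2 + s * c1 + r + s ^ 2) + f π ^ 3 * r ^ 3 + f π * t * (c3 + r * c1) +
        f π * r * t * c1)) := by
      rw [h6]; ring
    obtain ⟨c, hc⟩ : π ^ 2 ∣ V.a₆ := H.pow_dvd 2 _ (Dvd.intro _ e6.symm)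
    rw [hc, map_mul, map_pow] at e6
    obtain ⟨t₀, t', rfl⟩ := H.exists_sqrt h2' hF (c := c) (t := t) (by
      rw [mul_left_cancel₀ (pow_ne_zero 2 H.ne_zero) e6, add_sub_cancel_left, map_mul, hπ,
        zero_mul])
    refine exists_translate_of_translate 0 0 (π * t₀) (step3 _ r s t' ?_)
    exact isRescalable_translate _ _ _ h (by simp) (by simp) (by
      simp only [map_mul, map_zero]; ring)
  -- `r` modulo `π²` is read off from `a₂`
  have step1 : ∀ (V : WeierstrassCurve R) (r s t : S),
      IsRescalable (f π)
        ((⟨1, f π * r, f π * s, f π * t⟩ : VariableChange S) • V.map f) →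
      ∃ r s t : R, IsRescalable π ((⟨1, r, s, t⟩ : VariableChange R) • V) := by
    intro V r s t h
    obtain ⟨⟨c1, h1⟩, ⟨c2, h2⟩, -⟩ := expand h
    refine exists_translate_of_translate V.a₂ 0 0 (step2 _ (-(c2 + s * c1 + s ^ 2)) s t ?_)
    exact isRescalable_translate _ _ _ h
      (by rw [h2, h1]; ring) (by simp) (by simp)
  -- modulo `π`, square roots of `a₄`, `a₂ + r` and `a₆ + r a₄ + r² a₂ + r³` give `r`, `s` and `t`
  obtain ⟨⟨c1, h1⟩, ⟨c2, h2⟩, ⟨c3, h3⟩, ⟨c4, h4⟩, ⟨c6, h6⟩⟩ := expand h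
  rw [h1] at h2 h3 h4 h6
  rw [h3] at h4 h6
  obtain ⟨r₀, r', hr⟩ := H.exists_sqrt h2' hF (c := W.a₄) (t := r) (by
    rw [h4]; simp [hπ])
  obtain ⟨s₀, s', hs⟩ := H.exists_sqrt h2' hF (c := W.a₂ + r₀) (t := s) (by
    have : f r₀ = r - f π * r' := by rw [hr]; ring
    have e : f (W.a₂ + r₀) - s ^ 2 = f π * (f π * c2 + s * c1 - r') + r * 2 := by
      rw [map_add, h2, this]; ring
    rw [e, two]; simp [hπ])
  obtain ⟨t₀, t', ht⟩ := H.exists_sqrt h2' hF (c := W.a₆ + r₀ * W.a₄ + r₀ ^ 2 * W.a₂ + r₀ ^ 3)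
    (t := t) (by
    have : vS (f r₀) = vS r := by rw [hr]; simp [hπ]
    have two' : vS 2 = 0 := by rw [two, map_zero]
    rw [map_ofNat] at two'
    simp only [map_add, map_sub, map_mul, map_pow, this, h6, hπ]
    linear_combination (vS r * vS (f W.a₄) + vS r ^ 2 * vS (f W.a₂) + vS r ^ 3) * two')
  refine exists_translate_of_translate r₀ s₀ t₀ (step1 _ r' s' (t' - r' * f s₀) ?_)
  exact isRescalable_translate _ _ _ h (by rw [hr]; ring) (by rw [hs]; ring) (by rw [ht]; ring)

end Descent

/-! ### Minimal equations over a discrete valuation ring -/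

section Minimality

open WeierstrassCurve

variable {R K : Type*} [CommRing R] [Field K] [Algebra R K] [IsFractionRing R K]

theorem exists_algebraMap_eq_of_quartic [IsIntegrallyClosed R] {x : K} (c₀ c₁ c₂ c₃ : R)
    (h : x ^ 4 + algebraMap R K c₃ * x ^ 3 + algebraMap R K c₂ * x ^ 2 + algebraMap R K c₁ * x +
      algebraMap R K c₀ = 0) : ∃ a, algebraMap R K a = x := by
  refine IsIntegrallyClosed.isIntegral_iff.mp ⟨Polynomial.X ^ 4 + Polynomial.C c₃ *
    Polynomial.X ^ 3 + Polynomial.C c₂ * Polynomial.X ^ 2 + Polynomial.C c₁ * Polynomial.X +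
    Polynomial.C c₀, by monicity!, ?_⟩
  simpa using h

/-- A change of variables between integral equations is integral as soon as its `u` is: the
coefficients `r`, `s` and `t` are roots of monic polynomials, which come from `b₈`, `a₂` and `a₆`
respectively. -/
theorem exists_lift_translation [IsIntegrallyClosed R] (h3 : IsUnit (3 : R))
    {V : WeierstrassCurve K} {D : VariableChange K} (hV : IsIntegral R V)
    (hD : IsIntegral R (D • V)) (hu : ∃ a, algebraMap R K a = D.u) :
    (∃ a, algebraMap R K a = D.r) ∧ (∃ a, algebraMap R K a = D.s) ∧
      ∃ a, algebraMap R K a = D.t := by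
  obtain ⟨V, rfl⟩ := hV
  obtain ⟨V', hV'⟩ := hD
  obtain ⟨u, hu⟩ := hu
  obtain ⟨i3, hi3⟩ := h3.exists_left_inv
  replace hi3 : algebraMap R K i3 * 3 = 1 := by
    rw [← map_ofNat (algebraMap R K) 3, ← map_mul, hi3, map_one]
  have hu' : algebraMap R K u * (D.u⁻¹ : Kˣ) = 1 := by rw [hu]; exact D.u.mul_inv
  have hp (n : ℕ) : algebraMap R K u ^ n * (D.u⁻¹ : Kˣ) ^ n = 1 := by
    rw [← mul_pow, hu', one_pow]
  have hr : ∃ a, algebraMap R K a = D.r := by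
    have h := congrArg WeierstrassCurve.b₈ hV'
    rw [variableChange_b₈] at h
    simp only [baseChange, map_b₂, map_b₄, map_b₆, map_b₈] at h
    refine exists_algebraMap_eq_of_quartic (i3 * (V.b₈ - u ^ 8 * V'.b₈)) V.b₆ V.b₄ (i3 * V.b₂) ?_
    simp only [map_mul, map_sub, map_pow]
    rw [← h]
    linear_combination -algebraMap R K i3 * (algebraMap R K V.b₈ + 3 * D.r * algebraMap R K V.b₆ +
      3 * D.r ^ 2 * algebraMap R K V.b₄ + D.r ^ 3 * algebraMap R K V.b₂ + 3 * D.r ^ 4) * hp 8 -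
      (D.r ^ 4 + D.r ^ 2 * algebraMap R K V.b₄ + D.r * algebraMap R K V.b₆) * hi3
  obtain ⟨r, hr⟩ := hr
  refine ⟨⟨r, hr⟩, ?_, ?_⟩
  · have h := congrArg WeierstrassCurve.a₂ hV'
    rw [variableChange_a₂] at h
    simp only [baseChange, map_a₁, map_a₂] at h
    refine exists_algebraMap_eq_of_quartic 0 0 (u ^ 2 * V'.a₂ - V.a₂ - 3 * r) V.a₁ ?_
    simp only [map_mul, map_sub, map_pow, map_zero, map_ofNat]
    rw [← h, hr]
    linear_combination D.s ^ 2 * (algebraMap R K V.a₂ - D.s * algebraMap R K V.a₁ + 3 * D.r -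
      D.s ^ 2) * hp 2
  · have h := congrArg WeierstrassCurve.a₆ hV'
    rw [variableChange_a₆] at h
    simp only [baseChange, map_a₁, map_a₂, map_a₃, map_a₄, map_a₆] at h
    refine exists_algebraMap_eq_of_quartic 0 0
      (u ^ 6 * V'.a₆ - V.a₆ - r * V.a₄ - r ^ 2 * V.a₂ - r ^ 3) (V.a₃ + r * V.a₁) ?_
    simp only [map_mul, map_sub, map_add, map_pow, map_zero]
    rw [← h, hr]
    linear_combination D.t ^ 2 * (algebraMap R K V.a₆ + D.r * algebraMap R K V.a₄ +
      D.r ^ 2 * algebraMap R K V.a₂ + D.r ^ 3 - D.t * algebraMap R K V.a₃ - D.t ^ 2 -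
      D.r * D.t * algebraMap R K V.a₁) * hp 6

theorem exists_lift_inv_u [IsDomain R] [IsDiscreteValuationRing R] {V : WeierstrassCurve K}
    {D : VariableChange K} (h0 : V.Δ ≠ 0) (hV : IsMinimal R V) (hD : IsIntegral R (D • V)) :
    ∃ a, algebraMap R K a = (D.u⁻¹ : Kˣ) := by
  obtain ⟨r, hr⟩ := ((isMinimal_iff_dvd V).mp hV).2 D hD
  rw [variableChange_Δ] at hr
  have := mul_right_cancel₀ h0 hr
  refine IsIntegrallyClosed.isIntegral_iff.mp
    (_root_.IsIntegral.of_pow (n := 12) (by norm_num) ?_)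
  rw [this]
  exact isIntegral_algebraMap

/-- Two minimal equations of the same elliptic curve differ by an integral change of variables. -/
theorem exists_lift_change [IsDomain R] [IsDiscreteValuationRing R] (h3 : IsUnit (3 : R))
    {V : WeierstrassCurve K} {D : VariableChange K} (h0 : V.Δ ≠ 0) (hV : IsMinimal R V)
    (hD : IsMinimal R (D • V)) : ∃ E : VariableChange R, E.map (algebraMap R K) = D := by
  have iV : IsIntegral R V := inferInstance
  have iD : IsIntegral R (D • V) := inferInstance
  obtain ⟨a, ha⟩ := exists_lift_inv_u h0 hV iD
  obtain ⟨b, hb⟩ := exists_lift_inv_u (D := D⁻¹) (by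
    rw [variableChange_Δ]; exact mul_ne_zero (by simp) h0) hD (by rwa [inv_smul_smul])
  simp only [VariableChange.inv_def, inv_inv] at hb
  obtain ⟨⟨r, hr⟩, ⟨s, hs⟩, ⟨t, ht⟩⟩ := exists_lift_translation h3 iV iD ⟨b, hb⟩
  have hba : b * a = 1 := IsFractionRing.injective R K (by
    rw [map_mul, ha, hb, map_one]; exact D.u.mul_inv)
  refine ⟨⟨⟨b, a, hba, by rw [mul_comm, hba]⟩, r, s, t⟩, ?_⟩
  ext
  · exact hb
  · exact hr
  · exact hs
  · exact ht

/-- A minimal equation stays minimal over an unramified extension of discrete valuation rings. A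
change of variables with non-integral `u⁻¹` would make the equation rescalable after a translation,
and this descends. -/
theorem IsUnramifiedAt.isMinimal_map [IsDomain R] [IsDiscreteValuationRing R]
    {S K' F L : Type*} [CommRing S] [IsDomain S] [IsDiscreteValuationRing S] [Field K']
    [Algebra S K'] [IsFractionRing S K'] [Field F] [Field L] {f : R →+* S} {vR : R →+* F} {vS : S →+* L} {j : F →+* L} {π : R}
    (H : IsUnramifiedAt f vR vS j π) (e : K →+* K')
    (he : ∀ a, e (algebraMap R K a) = algebraMap S K' (f a)) (h3 : IsUnit (3 : R))
    (h2 : IsUnit (2 : R) ∨ (2 : R) = 0 ∧ ∀ c : F, ∃ d, d ^ 2 = c)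
    {V : WeierstrassCurve K} (h0 : V.Δ ≠ 0) (hV : IsMinimal R V) :
    IsMinimal S (V.map e) := by
  obtain ⟨V, rfl⟩ := (inferInstance : IsIntegral R V).integral
  have hmap : (V.baseChange K).map e = (V.map f).map (algebraMap S K') := by
    ext <;> exact he _
  have iS : IsIntegral S ((V.baseChange K).map e) := ⟨V.map f, hmap⟩
  refine (isMinimal_iff_dvd _).mpr ⟨iS, fun D hD => ?_⟩
  rw [variableChange_Δ]
  suffices h : ∃ a, algebraMap S K' a = (D.u⁻¹ : K'ˣ) by
    obtain ⟨a, ha⟩ := h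
    exact ⟨a ^ 12, by rw [map_pow, ha]⟩
  by_contra hu
  -- then `u` lies in the maximal ideal, so that the equation given by `D` can be rescaled
  have hu1 : ∃ a, algebraMap S K' a = D.u := by
    rcases ValuationRing.isInteger_or_isInteger S (D.u : K') with h | h
    · exact h
    · exact absurd (by rw [Units.val_inv_eq_inv_val]; exact h) hu
  obtain ⟨⟨r, hr⟩, ⟨s, hs⟩, ⟨t, ht⟩⟩ :=
    exists_lift_translation (by simpa only [map_ofNat] using h3.map f) iS hD hu1
  obtain ⟨u, hu1⟩ := hu1
  have hker : vS u = 0 := by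
    have hne : RingHom.ker vS ≠ ⊥ := fun h => H.ne_zero (by
      have : f π ∈ RingHom.ker vS := H.residue_map_pi
      rwa [h] at this)
    have hp : (RingHom.ker vS).IsPrime := RingHom.ker_isPrime _
    have hmax := IsLocalRing.eq_maximalIdeal (hp.isMaximal hne)
    change u ∈ RingHom.ker vS
    rw [hmax, IsLocalRing.mem_maximalIdeal, mem_nonunits_iff]
    intro hunit
    obtain ⟨v, hv⟩ := hunit.exists_right_inv
    refine hu ⟨v, ?_⟩
    have : (D.u : K') * algebraMap S K' v = 1 := by rw [← hu1, ← map_mul, hv, map_one]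
    rw [Units.val_inv_eq_inv_val]
    exact eq_inv_of_mul_eq_one_right this
  obtain ⟨w, rfl⟩ := H.dvd_map u hker
  obtain ⟨V', hV'⟩ := hD
  have hinj := IsFractionRing.injective S K'
  have hresc : IsRescalable (f π) ((⟨1, r, s, t⟩ : VariableChange S) • V.map f) := by
    have key : ((⟨1, r, s, t⟩ : VariableChange S) • V.map f).map (algebraMap S K') =
        (⟨D.u⁻¹, 0, 0, 0⟩ : VariableChange K') • V'.map (algebraMap S K') := by
      rw [← map_variableChange, map_translate, hr, hs, ht, ← hmap]
      change _ = _ • V'.baseChange K'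
      rw [← hV', ← mul_smul, VariableChange.mul_def]
      simp
    generalize (⟨1, r, s, t⟩ : VariableChange S) • V.map f = V₁ at key ⊢
    have e1 := congrArg WeierstrassCurve.a₁ key
    have e2 := congrArg WeierstrassCurve.a₂ key
    have e3 := congrArg WeierstrassCurve.a₃ key
    have e4 := congrArg WeierstrassCurve.a₄ key
    have e6 := congrArg WeierstrassCurve.a₆ key
    rw [variableChange_def] at e1 e2 e3 e4 e6
    simp only [map_a₁, map_a₂, map_a₃, map_a₄, map_a₆, inv_inv, mul_zero, zero_mul, add_zero,
      sub_zero, ne_eq, OfNat.ofNat_ne_zero, not_false_eq_true, zero_pow, ← hu1, ← map_mul,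
      ← map_pow] at e1 e2 e3 e4 e6
    refine ⟨⟨w * V'.a₁, ?_⟩, ⟨w ^ 2 * V'.a₂, ?_⟩, ⟨w ^ 3 * V'.a₃, ?_⟩, ⟨w ^ 4 * V'.a₄, ?_⟩,
      ⟨w ^ 6 * V'.a₆, ?_⟩⟩
    · rw [hinj e1]; ring
    · rw [hinj e2]; ring
    · rw [hinj e3]; ring
    · rw [hinj e4]; ring
    · rw [hinj e6]; ring
  obtain ⟨r₀, s₀, t₀, h⟩ : ∃ r s t : R, IsRescalable π ((⟨1, r, s, t⟩ : VariableChange R) • V) :=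
    h2.elim (fun h2 => H.descend_of_isUnit_two h2 h3 hresc)
      (fun h2 => H.descend_of_two_eq_zero h2.1 h2.2 hresc)
  -- rescaling by `u = π` contradicts minimality over `R`
  have hπK : algebraMap R K π ≠ 0 := by
    rw [Ne, FaithfulSMul.algebraMap_eq_zero_iff]
    rintro rfl
    exact H.ne_zero (map_zero f)
  have hint : IsIntegral R (((⟨Units.mk0 _ hπK, 0, 0, 0⟩ : VariableChange K) *
      (⟨1, r₀, s₀, t₀⟩ : VariableChange R).map (algebraMap R K)) • V.baseChange K) := by
    rw [mul_smul, baseChange, map_variableChange]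
    obtain ⟨⟨c1, h1⟩, ⟨c2, h2⟩, ⟨c3, h3⟩, ⟨c4, h4⟩, ⟨c6, h6⟩⟩ := h
    refine ⟨⟨c1, c2, c3, c4, c6⟩, ?_⟩
    rw [variableChange_def]
    ext <;> simp [baseChange, map_a₁, map_a₂, map_a₃, map_a₄, map_a₆, h1, h2, h3, h4, h6, hπK]
  obtain ⟨a, ha⟩ := exists_lift_inv_u h0 hV hint
  have : a * π = 1 := IsFractionRing.injective R K (by
    rw [map_mul, ha, VariableChange.mul_def]
    simp [hπK])
  have h1 := congrArg vR this
  rw [map_mul, H.map_pi, mul_zero, map_one] at h1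
  exact zero_ne_one h1

end Minimality

/-! ### Local rings along the cubic cover -/

section LocalRings

theorem chart_infty {k L : Type*} [Field k] [Field L] :
    chart k (∞ : OnePoint L) = (subst RatFunc.X⁻¹ inv_ne_C, 0) := rfl

theorem chart_coe {k L : Type*} [Field k] [Field L] (x : L) :
    chart k (x : OnePoint L) = (AlgHom.id k _, x) := rfl

variable {k : Type*} [Field k] {L : Type*} [Field L] [Algebra k L]

/-- The map `s ↦ (s³ - 3s² + 1) / (3s² - 3s)` on the points of the projective line; its poles are
`0`, `1` and `∞`. -/
noncomputable def phiPoint : OnePoint L → OnePoint L :=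
  open Classical in
  fun p => p.elim ∞ fun x => if x = 0 ∨ x = 1 then ∞ else
    (((x ^ 3 - 3 * x ^ 2 + 1) / (3 * x ^ 2 - 3 * x) : L) : OnePoint L)

theorem phiPoint_infty : phiPoint (∞ : OnePoint L) = ∞ := rfl

theorem phiPoint_zero : phiPoint ((0 : L) : OnePoint L) = ∞ := by simp [phiPoint]

theorem phiPoint_one : phiPoint ((1 : L) : OnePoint L) = ∞ := by simp [phiPoint]

theorem phiPoint_coe {x : L} (h0 : x ≠ 0) (h1 : x ≠ 1) : phiPoint (x : OnePoint L) =
    (((x ^ 3 - 3 * x ^ 2 + 1) / (3 * x ^ 2 - 3 * x) : L) : OnePoint L) := by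
  simp [phiPoint, h0, h1]

/-- The points of the projective line at which the cubic cover is unramified: `∞`, and the finite
points `x` with `x² - x + 1 ≠ 0`. -/
def IsUnramifiedPoint (p : OnePoint L) : Prop := ∀ x : L, p = x → x ^ 2 - x + 1 ≠ 0

theorem three_ne_zero_of_algebra (k : Type*) [Field k] [h3 : NeZero (3 : k)] {L : Type*} [Field L]
    [Algebra k L] : (3 : L) ≠ 0 := by
  rw [← map_ofNat (algebraMap k L) 3, Ne, FaithfulSMul.algebraMap_eq_zero_iff]
  exact h3.out

/-- The cubic cover in the charts at `s` and `φ(s)`, written as a quotient `a / b` of polynomials.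
At an unramified point it has a non-zero derivative. -/
theorem exists_chart_phi [NeZero (3 : k)] (s : OnePoint L) :
    ∃ a b : k[X], (chart k s).1 (subst (phiFun k) phiFun_ne_C
        ((chart k (phiPoint s)).1 RatFunc.X)) =
          algebraMap k[X] (RatFunc k) a / algebraMap k[X] (RatFunc k) b ∧
      Polynomial.aeval (chart k s).2 b ≠ 0 ∧
      Polynomial.aeval (chart k s).2 a =
        (chart k (phiPoint s)).2 * Polynomial.aeval (chart k s).2 b ∧
      (IsUnramifiedPoint s → Polynomial.aeval (chart k s).2 a.derivative -
        (chart k (phiPoint s)).2 * Polynomial.aeval (chart k s).2 b.derivative ≠ 0) := by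
  have h3 : (3 : L) ≠ 0 := three_ne_zero_of_algebra k
  have hX0 : (RatFunc.X : RatFunc k) ≠ 0 := RatFunc.X_ne_zero
  have inf : (chart k (∞ : OnePoint L)).1 RatFunc.X = RatFunc.X⁻¹ := subst_X _ inv_ne_C
  induction s using OnePoint.rec with
  | infty =>
    refine ⟨3 * Polynomial.X - 3 * Polynomial.X ^ 2, Polynomial.X ^ 3 - 3 * Polynomial.X + 1,
      ?_, ?_, ?_, fun _ => ?_⟩
    · rw [phiPoint_infty, inf, map_inv₀, subst_X, phiFun]
      simp only [map_inv₀, map_div₀, map_add, map_sub, map_mul, map_pow, map_one, map_ofNat, inf,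
        RatFunc.algebraMap_X]
      have : (3 * RatFunc.X⁻¹ ^ 2 - 3 * RatFunc.X⁻¹ : RatFunc k) =
          (3 * RatFunc.X - 3 * RatFunc.X ^ 2) / RatFunc.X ^ 3 := by field_simp
      rw [this]
      have : (RatFunc.X⁻¹ ^ 3 - 3 * RatFunc.X⁻¹ ^ 2 + 1 : RatFunc k) =
          (RatFunc.X ^ 3 - 3 * RatFunc.X + 1) / RatFunc.X ^ 3 := by field_simp; ring
      rw [this, inv_div, div_div_div_cancel_right₀ (pow_ne_zero 3 hX0)]
    · simp [chart_infty]
    · simp [chart_infty, phiPoint_infty]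
    · simpa [chart_infty, phiPoint_infty, map_ofNat] using h3
  | coe x =>
    by_cases h : x = 0 ∨ x = 1
    · have hp : phiPoint (x : OnePoint L) = ∞ := by simp [phiPoint, h]
      rw [hp]
      refine ⟨3 * Polynomial.X ^ 2 - 3 * Polynomial.X, Polynomial.X ^ 3 - 3 * Polynomial.X ^ 2 + 1,
        ?_, ?_, ?_, fun _ => ?_⟩
      · rw [inf, map_inv₀, subst_X, phiFun]
        simp [chart_coe, map_ofNat]
      · rcases h with rfl | rfl
        · simp [chart_coe]
        · norm_num [chart_coe, map_ofNat]
      · rcases h with rfl | rfl <;> simp [chart_coe, chart_infty]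
      · rcases h with rfl | rfl
        · simpa [chart_coe, chart_infty, map_ofNat] using h3
        · have : (3 * (1 + 1) - 3 : L) = 3 := by norm_num
          simpa [chart_coe, chart_infty, map_ofNat, this] using h3
    · rw [not_or] at h
      have hb : 3 * x ^ 2 - 3 * x ≠ 0 := by
        have : 3 * x ^ 2 - 3 * x = 3 * x * (x - 1) := by ring
        rw [this]
        exact mul_ne_zero (mul_ne_zero h3 h.1) (sub_ne_zero.mpr h.2)
      rw [phiPoint_coe h.1 h.2]
      refine ⟨Polynomial.X ^ 3 - 3 * Polynomial.X ^ 2 + 1, 3 * Polynomial.X ^ 2 - 3 * Polynomial.X,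
        ?_, ?_, ?_, fun hs => ?_⟩
      · simp [chart_coe, subst_X, phiFun, map_ofNat]
      · simpa [chart_coe, map_ofNat] using hb
      · simp [chart_coe, map_ofNat, div_mul_cancel₀ _ hb]
      · have hx := hs x rfl
        simp only [chart_coe, Polynomial.derivative_X_pow, Polynomial.derivative_one,
          Polynomial.derivative_mul, Polynomial.derivative_ofNat, Polynomial.derivative_X,
          map_sub, map_add, map_mul, map_pow, map_ofNat, map_one, map_zero, Polynomial.aeval_X, map_natCast]
        intro h
        have : 3 * (x ^ 2 - x + 1) ^ 2 = 0 := by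
          rw [div_mul_eq_mul_div, sub_eq_zero, eq_div_iff hb] at h
          push_cast at h
          linear_combination h
        exact mul_ne_zero h3 (pow_ne_zero 2 hx) this

theorem subst_phi_mem [NeZero (3 : k)] (s : OnePoint L) (f : RatFunc k)
    (hf : f ∈ localRing k (phiPoint s)) :
    ∃ h : subst (phiFun k) phiFun_ne_C f ∈ localRing k s,
      evalAt k s ⟨_, h⟩ = evalAt k (phiPoint s) ⟨f, hf⟩ := by
  obtain ⟨a, b, he, hb, hab, -⟩ := exists_chart_phi (k := k) s
  have h1 : ∀ c : k[X], affineEval k (chart k s).2 ⟨_, algebraMap_mem_affineRing _ c⟩ =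
      Polynomial.aeval (chart k s).2 c := fun c => by rw [affineEval_apply]; simp
  obtain ⟨hx, hy⟩ := div_mem_affineRing (x := (chart k s).2) ⟨_, algebraMap_mem_affineRing _ a⟩
    ⟨_, algebraMap_mem_affineRing _ b⟩ (by rw [h1]; exact hb)
  rw [h1, h1, hab, mul_div_cancel_right₀ _ hb] at hy
  let E : RatFunc k →ₐ[k] RatFunc k := (chart k s).1.comp
    ((subst (phiFun k) phiFun_ne_C).comp (chart k (phiPoint s)).1)
  have hE : E RatFunc.X = algebraMap k[X] (RatFunc k) a / algebraMap k[X] (RatFunc k) b := he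
  have hg : ¬ ∃ c, algebraMap k[X] (RatFunc k) a / algebraMap k[X] (RatFunc k) b =
      RatFunc.C c := by
    rintro ⟨c, hc⟩
    rw [← hE, ← RatFunc.algebraMap_eq_C, ← E.commutes] at hc
    have hX := E.toRingHom.injective hc
    rw [RatFunc.algebraMap_eq_C, ← RatFunc.algebraMap_X, ← RatFunc.algebraMap_C] at hX
    exact Polynomial.X_ne_C c (RatFunc.algebraMap_injective k hX)
  have e : E = subst _ hg := algHom_ext_X (hE.trans (subst_X _ hg).symm)
  have e' : (chart k s).1 (subst (phiFun k) phiFun_ne_C f) =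
      subst _ hg ((chart k (phiPoint s)).1 f) := by
    rw [← e]
    change _ = (chart k s).1 (subst (phiFun k) phiFun_ne_C ((chart k (phiPoint s)).1
      ((chart k (phiPoint s)).1 f)))
    rw [chart_chart]
  obtain ⟨h, h'⟩ := affineEval_subst (hg := hg) hx hy (f := (chart k (phiPoint s)).1 f) hf
  have hm : subst (phiFun k) phiFun_ne_C f ∈ localRing k s := by
    change (chart k s).1 _ ∈ affineRing k _
    rw [e']; exact h
  refine ⟨hm, Eq.trans ?_ h'⟩
  change affineEval k _ ⟨(chart k s).1 _, hm⟩ = _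
  congr 1
  exact Subtype.ext e'

/-- A quotient of polynomials with a simple zero at `x` is a uniformizer at `x`. -/
theorem div_mem_affineRing_of_simple_zero [Algebra.IsAlgebraic k L] {x : L} {a b : k[X]}
    (ha : Polynomial.aeval x a = 0) (ha' : Polynomial.aeval x a.derivative ≠ 0)
    {f : RatFunc k} (hf : f ∈ affineRing k x) (hf0 : affineEval k x ⟨f, hf⟩ = 0) :
    f / (algebraMap k[X] (RatFunc k) a / algebraMap k[X] (RatFunc k) b) ∈ affineRing k x := by
  have hnum : Polynomial.aeval x f.num = 0 := by
    rw [affineEval_apply] at hf0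
    exact (div_eq_zero_iff.mp hf0).resolve_right hf
  obtain ⟨c, rfl⟩ := minpoly.dvd k x ha
  obtain ⟨d, hd⟩ := minpoly.dvd k x hnum
  have hc : Polynomial.aeval x c ≠ 0 := by
    intro h
    apply ha'
    rw [Polynomial.derivative_mul, map_add, map_mul, map_mul, h, minpoly.aeval]
    simp
  have hm : algebraMap k[X] (RatFunc k) (minpoly k x) ≠ 0 := by
    simpa using minpoly.ne_zero (Algebra.IsAlgebraic.isAlgebraic x).isIntegral
  have e : f / (algebraMap k[X] (RatFunc k) (minpoly k x * c) / algebraMap k[X] (RatFunc k) b) =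
      algebraMap k[X] (RatFunc k) (d * b) / algebraMap k[X] (RatFunc k) (f.denom * c) := by
    conv_lhs => rw [← RatFunc.num_div_denom f, hd]
    rw [map_mul, map_mul, map_mul, map_mul, div_div_div_eq, mul_assoc, mul_left_comm _ _
      (algebraMap k[X] (RatFunc k) c), mul_div_mul_left _ _ hm]
  rw [e]
  exact mem_affineRing_of_div (by rw [map_mul]; exact mul_ne_zero hf hc)

theorem chart_map {L' : Type*} [Field L'] [Algebra k L'] (τ : L →ₐ[k] L') (p : OnePoint L) :
    chart k (p.map τ) = ((chart k p).1, τ (chart k p).2) := by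
  induction p using OnePoint.rec with
  | infty => simp [chart]
  | coe x => rfl

theorem C_mem_localRing (p : OnePoint L) (c : k) :
    ∃ h : RatFunc.C c ∈ localRing k p, evalAt k p ⟨RatFunc.C c, h⟩ = algebraMap k L c := by
  have e : (chart k p).1 (RatFunc.C c) = RatFunc.C c := (chart k p).1.commutes c
  have h : RatFunc.C c ∈ localRing k p := by
    change (chart k p).1 _ ∈ affineRing k _
    rw [e, ← RatFunc.algebraMap_C]
    exact algebraMap_mem_affineRing _ _
  refine ⟨h, ?_⟩
  change Polynomial.aeval (chart k p).2 ((chart k p).1 (RatFunc.C c)).num /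
    Polynomial.aeval (chart k p).2 ((chart k p).1 (RatFunc.C c)).denom = _
  rw [e]
  simp

theorem isUnit_algebraMap_localRing (p : OnePoint L) {c : k} (hc : c ≠ 0) (a : localRing k p)
    (ha : (a : RatFunc k) = RatFunc.C c) : IsUnit a := by
  refine IsUnit.of_mul_eq_one ⟨_, (C_mem_localRing p c⁻¹).1⟩ (Subtype.ext ?_)
  change (a : RatFunc k) * RatFunc.C c⁻¹ = 1
  rw [ha, ← map_mul, mul_inv_cancel₀ hc, map_one]

theorem isUnit_three_localRing [h3 : NeZero (3 : k)] (p : OnePoint L) :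
    IsUnit (3 : localRing k p) :=
  isUnit_algebraMap_localRing p h3.out 3 (by rw [map_ofNat]; rfl)

/-- Substitution of `φ` as a map of the local rings of two points `s` and `t = φ(s)`. -/
theorem exists_isUnramifiedAt_phi [NeZero (3 : k)] [Algebra.IsAlgebraic k L] {s : OnePoint L}
    (hs : IsUnramifiedPoint s) {t : OnePoint k} (hst : phiPoint s = t.map (Algebra.ofId k L)) :
    ∃ (f : localRing k t →+* localRing k s) (π : localRing k t),
      (∀ a : localRing k t, subst (phiFun k) phiFun_ne_C (a : RatFunc k) = f a) ∧
        IsUnramifiedAt f (evalAt k t) (evalAt k s) (algebraMap k L) π := by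
  have hmem : ∀ a (ha : a ∈ localRing k t), ∃ h : subst (phiFun k) phiFun_ne_C a ∈ localRing k s,
      evalAt k s ⟨_, h⟩ = algebraMap k L (evalAt k t ⟨a, ha⟩) := by
    intro a ha
    have hc := compatible_map (Algebra.ofId k L) t
    rw [← hst] at hc
    obtain ⟨h, h'⟩ := subst_phi_mem s a ((hc.mem_iff a).mpr ha)
    exact ⟨h, h'.trans (hc.eval_eq a ha _)⟩
  let e : RatFunc k →+* RatFunc k := subst (phiFun k) phiFun_ne_C
  let f : localRing k t →+* localRing k s := e.restrict _ _ fun a ha => (hmem a ha).1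
  obtain ⟨a, b, he, hb, hab, hsimple⟩ := exists_chart_phi (k := k) s
  replace hsimple := hsimple hs
  rw [hst, chart_map] at he hab hsimple
  dsimp only at he hab hsimple
  set t' : k := (chart k t).2
  let g : k[X] := Polynomial.X - Polynomial.C t'
  let ϖ : RatFunc k := (chart k t).1 (algebraMap k[X] (RatFunc k) g)
  have hϖ1 : (chart k t).1 ϖ = algebraMap k[X] (RatFunc k) g := chart_chart _ _
  have hϖ : ϖ ∈ localRing k t := by
    change (chart k t).1 ϖ ∈ affineRing k _
    rw [hϖ1]
    exact algebraMap_mem_affineRing _ _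
  have hϖ0 : evalAt k t ⟨ϖ, hϖ⟩ = 0 := by
    change Polynomial.aeval t' ((chart k t).1 ϖ).num /
      Polynomial.aeval t' ((chart k t).1 ϖ).denom = _
    rw [hϖ1, RatFunc.num_algebraMap]
    simp [g]
  have hb0 : algebraMap k[X] (RatFunc k) b ≠ 0 := by
    intro h
    have : b = 0 := RatFunc.algebraMap_injective k (by rw [h, map_zero])
    rw [this, map_zero] at hb
    exact hb rfl
  have heϖ : (chart k s).1 (e ϖ) = algebraMap k[X] (RatFunc k) (a - Polynomial.C t' * b) /
      algebraMap k[X] (RatFunc k) b := by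
    have : ϖ = (chart k t).1 RatFunc.X - RatFunc.C t' := by
      change (chart k t).1 (algebraMap k[X] (RatFunc k) (Polynomial.X - Polynomial.C t')) = _
      rw [map_sub, map_sub, RatFunc.algebraMap_X, RatFunc.algebraMap_C]
      exact congrArg _ ((chart k t).1.commutes t')
    have hC : (chart k s).1 (e (RatFunc.C t')) = RatFunc.C t' :=
      (congrArg (chart k s).1 ((subst (phiFun k) phiFun_ne_C).commutes t')).trans
        ((chart k s).1.commutes t')
    rw [this, map_sub, map_sub, hC]
    change (chart k s).1 (subst (phiFun k) phiFun_ne_C _) - _ = _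
    rw [he, map_sub, map_mul, RatFunc.algebraMap_C, sub_div, mul_div_cancel_right₀ _ hb0]
  have hzero : Polynomial.aeval (chart k s).2 (a - Polynomial.C t' * b) = 0 := by
    rw [map_sub, map_mul, Polynomial.aeval_C, hab]
    exact sub_self _
  have hsimple' : Polynomial.aeval (chart k s).2 (a - Polynomial.C t' * b).derivative ≠ 0 := by
    rw [Polynomial.derivative_sub, Polynomial.derivative_C_mul, map_sub, map_mul,
      Polynomial.aeval_C]
    exact hsimple
  have hne : (a - Polynomial.C t' * b) ≠ 0 := by
    intro h
    rw [h, Polynomial.derivative_zero, map_zero] at hsimple'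
    exact hsimple' rfl
  refine ⟨f, ⟨ϖ, hϖ⟩, fun _ => rfl, ⟨?_, ?_, hϖ0, ?_, ?_, ?_⟩⟩
  · exact fun c => ⟨_, (C_mem_localRing t c).2⟩
  · exact fun x => (hmem x x.2).2
  · intro x hx
    have h := div_mem_affineRing_of_simple_zero (b := 1) (x := t') (a := g) (by simp [g])
      (by simp [g]) (f := (chart k t).1 x) x.2 hx
    rw [map_one, div_one, ← hϖ1, ← map_div₀] at h
    refine ⟨⟨_, h⟩, Subtype.ext (mul_div_cancel₀ _ ?_).symm⟩
    intro h0
    replace h0 : ϖ = 0 := h0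
    rw [h0, map_zero] at hϖ1
    exact Polynomial.X_sub_C_ne_zero t' (RatFunc.algebraMap_injective k (by rw [← hϖ1, map_zero]))
  · intro y hy
    have h := div_mem_affineRing_of_simple_zero (b := b) hzero hsimple'
      (f := (chart k s).1 y) y.2 hy
    rw [← heϖ, ← map_div₀] at h
    refine ⟨⟨_, h⟩, Subtype.ext (mul_div_cancel₀ _ ?_).symm⟩
    intro h0
    replace h0 : e ϖ = 0 := h0
    rw [h0, map_zero, eq_comm, div_eq_zero_iff] at heϖ
    exact hne (RatFunc.algebraMap_injective k (by rw [heϖ.resolve_right hb0, map_zero]))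
  · intro h0
    have h0 : e ϖ = 0 := congrArg Subtype.val h0
    rw [h0, map_zero, eq_comm, div_eq_zero_iff] at heϖ
    exact hne (RatFunc.algebraMap_injective k (by rw [heϖ.resolve_right hb0, map_zero]))

end LocalRings

/-! ### Coordinates on the fibres of a Weierstrass model -/

section Representatives

open WeierstrassCurve

theorem changeCoord_one {L : Type*} [Field L] (P : Option (L × L)) :
    changeCoord (1 : VariableChange L) P = P := by
  rcases P with _ | P <;> simp [changeCoord, VariableChange.one_def]

theorem changeCoord_mul {L : Type*} [Field L] (C D : VariableChange L) (P : Option (L × L)) :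
    changeCoord (C * D) P = changeCoord D (changeCoord C P) := by
  rcases P with _ | P
  · rfl
  · simp only [changeCoord, VariableChange.mul_def, Option.map_some, Units.val_mul,
      Option.some.injEq, Prod.mk.injEq]
    constructor <;> ring

theorem equation_of_changeCoord {L : Type*} [Field L] (V : WeierstrassCurve L)
    (D : VariableChange L) {Q : Option (L × L)}
    (h : ∀ P ∈ changeCoord D Q, V.toAffine.Equation P.1 P.2) :
    ∀ P ∈ Q, (D • V).toAffine.Equation P.1 P.2 := by
  intro P hP
  have h := h _ (Option.mem_map_of_mem _ hP)
  rw [Affine.equation_iff'] at h ⊢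
  have hu : (D.u : L) * (D.u⁻¹ : Lˣ) = 1 := D.u.mul_inv
  have hp (n : ℕ) : (D.u : L) ^ n * (D.u⁻¹ : Lˣ) ^ n = 1 := by rw [← mul_pow, hu, one_pow]
  have h6 : (D.u : L) ^ 6 ≠ 0 := pow_ne_zero 6 D.u.ne_zero
  rw [variableChange_def]
  apply mul_left_cancel₀ h6
  rw [mul_zero, ← h]
  dsimp only
  generalize ((D.u⁻¹ : Lˣ) : L) = v at *
  generalize (D.u : L) = u at *
  have e1 : u * v = 1 := hu
  have e2 : u ^ 2 * v ^ 2 = 1 := hp 2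
  have e3 : u ^ 3 * v ^ 3 = 1 := hp 3
  have e4 : u ^ 4 * v ^ 4 = 1 := hp 4
  have e6 : u ^ 6 * v ^ 6 = 1 := hp 6
  linear_combination u ^ 5 * P.1 * P.2 * (V.a₁ + 2 * D.s) * e1 -
    u ^ 4 * P.1 ^ 2 * (V.a₂ - D.s * V.a₁ + 3 * D.r - D.s ^ 2) * e2 +
    u ^ 3 * P.2 * (V.a₃ + D.r * V.a₁ + 2 * D.t) * e3 -
    u ^ 2 * P.1 * (V.a₄ - D.s * V.a₃ + 2 * D.r * V.a₂ - (D.t + D.r * D.s) * V.a₁ + 3 * D.r ^ 2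
      - 2 * D.s * D.t) * e4 -
    (V.a₆ + D.r * V.a₄ + D.r ^ 2 * V.a₂ + D.r ^ 3 - D.t * V.a₃ - D.t ^ 2
      - D.r * D.t * V.a₁) * e6

variable {k : Type*} [Field k] {L : Type*} [Field L] [Algebra k L]

theorem map_subtype_injective (p : OnePoint L) :
    Function.Injective
      fun E : VariableChange (localRing k p) => E.map (localRing k p).subtype :=
  VariableChange.map_injective (φ := (localRing k p).subtype) (Subring.subtype_injective _)

variable [Algebra.IsAlgebraic k L]

theorem reducedCurve_variableChange {p : OnePoint L} {V : WeierstrassCurve (RatFunc k)}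
    (E : VariableChange (localRing k p)) [IsMinimal (localRing k p) V]
    [IsMinimal (localRing k p) (E.map (localRing k p).subtype • V)] :
    reducedCurve (E.map (localRing k p).subtype • V) p =
      E.map (evalAt k p) • reducedCurve V p := by
  rw [reducedCurve, reducedCurve, map_variableChange]
  congr 1
  apply map_injective (IsFractionRing.injective (localRing k p) (RatFunc k))
  change (integralModel _ _).baseChange (RatFunc k) = (E • integralModel _ V).map _
  rw [baseChange_integralModel_eq, ← map_variableChange]
  change _ = _ • (integralModel _ _).baseChange (RatFunc k)
  rw [baseChange_integralModel_eq]
  rfl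

/-- The point of the fibre above `p` with the coordinates `Q` in the equation `C • W`. -/
def mkFibre (W : WeierstrassCurve (RatFunc k)) (p : OnePoint L) (C : VariableChange (RatFunc k))
    (hC : IsMinimal (localRing k p) (C • W)) (Q : Option (L × L))
    (hQ : ∀ P ∈ Q, (reducedCurve (C • W) p).toAffine.Equation P.1 P.2) : Fibre W p :=
  Quotient.mk _ { change := C, minimal := hC, point := Q, equation := hQ }

/-- The point `P` of the Weierstrass model lies above `p` and has the coordinates `Q` in the
equation `C • W`, which is minimal at `p`. -/
def HasCoords {W : WeierstrassCurve (RatFunc k)} (P : WeierstrassModel W L) (p : OnePoint L)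
    (C : VariableChange (RatFunc k)) (Q : Option (L × L)) : Prop :=
  ∃ hC hQ, P = ⟨p, mkFibre W p C hC Q hQ⟩

theorem HasCoords.eq {W : WeierstrassCurve (RatFunc k)} {P P' : WeierstrassModel W L}
    {p : OnePoint L} {C : VariableChange (RatFunc k)} {Q : Option (L × L)}
    (h : HasCoords P p C Q) (h' : HasCoords P' p C Q) : P = P' := by
  obtain ⟨_, _, rfl⟩ := h
  obtain ⟨_, _, rfl⟩ := h'
  rfl

theorem HasCoords.fst_eq {W : WeierstrassCurve (RatFunc k)} {P : WeierstrassModel W L}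
    {p : OnePoint L} {C : VariableChange (RatFunc k)} {Q : Option (L × L)}
    (h : HasCoords P p C Q) : P.1 = p := by
  obtain ⟨_, _, rfl⟩ := h
  rfl

/-- The coordinates in two equations are related by a change of coordinates that does not depend on
the point. -/
theorem HasCoords.exists_change {W : WeierstrassCurve (RatFunc k)} (p : OnePoint L)
    (C C' : VariableChange (RatFunc k)) :
    ∃ D : VariableChange (localRing k p), (C = C' → D = 1) ∧
      ∀ {P : WeierstrassModel W L} {Q Q' : Option (L × L)}, HasCoords P p C Q →
        HasCoords P p C' Q' → Q' = changeCoord (D.map (evalAt k p)) Q := by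
  by_cases hE : ∃ E : VariableChange (localRing k p), C = E.map (localRing k p).subtype * C'
  · obtain ⟨E, hE⟩ := hE
    refine ⟨E, ?_, ?_⟩
    · rintro rfl
      apply map_subtype_injective
      change E.map _ = (1 : VariableChange _).map _
      rw [map_one_change]
      exact right_eq_mul.mp hE
    · rintro P Q Q' ⟨hC, hQ, rfl⟩ ⟨hC', hQ', h⟩
      obtain ⟨D, hD, hD'⟩ := Quotient.exact (eq_of_heq (Sigma.mk.inj h).2).symm
      replace hD : C = D.map (localRing k p).subtype * C' := hD
      rw [hE] at hD
      rw [map_subtype_injective p (mul_right_cancel hD)]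
      exact hD'
  · refine ⟨1, fun _ => rfl, ?_⟩
    rintro P Q Q' ⟨hC, hQ, rfl⟩ ⟨hC', hQ', h⟩
    obtain ⟨D, hD, -⟩ := Quotient.exact (eq_of_heq (Sigma.mk.inj h).2).symm
    exact absurd ⟨D, hD⟩ hE

theorem HasCoords.coords_eq {W : WeierstrassCurve (RatFunc k)} {P : WeierstrassModel W L}
    {p : OnePoint L} {C : VariableChange (RatFunc k)} {Q Q' : Option (L × L)}
    (h : HasCoords P p C Q) (h' : HasCoords P p C Q') : Q = Q' := by
  obtain ⟨D, hD, hD'⟩ := HasCoords.exists_change (W := W) p C C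
  rw [hD' h h', hD rfl, map_one_change, changeCoord_one]

theorem exists_hasCoords [NeZero (3 : k)] {W : WeierstrassCurve (RatFunc k)} [W.IsElliptic]
    (P : WeierstrassModel W L) {C : VariableChange (RatFunc k)}
    (hC : IsMinimal (localRing k P.1) (C • W)) : ∃ Q, HasCoords P P.1 C Q := by
  obtain ⟨p, x⟩ := P
  dsimp only at hC ⊢
  obtain ⟨P, rfl⟩ := Quotient.exists_rep x
  have hCP : C * P.change⁻¹ * P.change = C := inv_mul_cancel_right _ _
  have hC' : IsMinimal (localRing k p) ((C * P.change⁻¹) • P.change • W) := by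
    rwa [← mul_smul, hCP]
  obtain ⟨E, hE⟩ := exists_lift_change (isUnit_three_localRing p)
    (P.change • W).isUnit_Δ.ne_zero P.minimal hC'
  replace hE : E.map (localRing k p).subtype = C * P.change⁻¹ := hE
  have hE' : C = E.map (localRing k p).subtype * P.change := by rw [hE, hCP]
  have hcoord : changeCoord (E.map (evalAt k p)) (changeCoord (E⁻¹.map (evalAt k p)) P.point) =
      P.point := by
    rw [← changeCoord_mul, ← map_mul_change, inv_mul_cancel, map_one_change, changeCoord_one]
  refine ⟨changeCoord (E⁻¹.map (evalAt k p)) P.point, hC, ?_, ?_⟩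
  · subst hE'
    have := hC
    simp only [mul_smul] at this ⊢
    rw [reducedCurve_variableChange]
    apply equation_of_changeCoord
    rw [hcoord]
    exact P.equation
  · refine Sigma.ext rfl (heq_of_eq (Quotient.sound ⟨E, hE', hcoord.symm⟩))

theorem bijective_mkFibre [NeZero (3 : k)] {W : WeierstrassCurve (RatFunc k)} [W.IsElliptic]
    {p : OnePoint L} {C : VariableChange (RatFunc k)}
    [hC : IsMinimal (localRing k p) (C • W)] :
    Function.Bijective fun Q : {Q : Option (L × L) //
      ∀ P ∈ Q, (reducedCurve (C • W) p).toAffine.Equation P.1 P.2} =>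
        mkFibre W p C hC Q.1 Q.2 := by
  constructor
  · rintro ⟨Q, hQ⟩ ⟨Q', hQ'⟩ h
    exact Subtype.ext (HasCoords.coords_eq (W := W) ⟨hC, hQ, rfl⟩ ⟨hC, hQ', Sigma.ext rfl
      (heq_of_eq h)⟩)
  · intro x
    obtain ⟨Q, _, hQ, h⟩ := exists_hasCoords (⟨p, x⟩ : WeierstrassModel W L) hC
    exact ⟨⟨Q, hQ⟩, (eq_of_heq (Sigma.mk.inj h).2).symm⟩

theorem HasCoords.sigma [NeZero (3 : k)] {W : WeierstrassCurve (RatFunc k)}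
    {P : WeierstrassModel (cubicBaseChange W) L} {p : OnePoint L}
    {C : VariableChange (RatFunc k)} {Q : Option (L × L)} (h : HasCoords P p C Q) :
    HasCoords (EllipticSurface.sigma W P) (sigmaPoint p)
      (C.map (sigmaField k : RatFunc k →+* RatFunc k)) Q := by
  obtain ⟨hC, hQ, rfl⟩ := h
  have hid : Q.map (fun P => (AlgHom.id k L P.1, AlgHom.id k L P.2)) = Q := by
    cases Q <;> rfl
  have := (LocalPoint.transport (compatible_sigma p) (cubicBaseChange_sigma W)
    { change := C, minimal := hC, point := Q, equation := hQ }).equation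
  change ∀ P ∈ Q.map (fun P => (AlgHom.id k L P.1, AlgHom.id k L P.2)), _ at this
  refine ⟨(LocalPoint.transport (compatible_sigma p) (cubicBaseChange_sigma W)
    { change := C, minimal := hC, point := Q, equation := hQ }).minimal, ?_, ?_⟩
  · rw [hid] at this
    exact this
  · refine Sigma.ext rfl (heq_of_eq (Quotient.sound ⟨1, ?_, ?_⟩))
    · rw [map_one_change, one_mul]
      rfl
    · rw [map_one_change, changeCoord_one]
      exact hid

theorem HasCoords.sigma_iterate [NeZero (3 : k)] {W : WeierstrassCurve (RatFunc k)} (n : ℕ)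
    {P : WeierstrassModel (cubicBaseChange W) L} {p : OnePoint L}
    {C : VariableChange (RatFunc k)} {Q : Option (L × L)} (h : HasCoords P p C Q) :
    HasCoords ((EllipticSurface.sigma W)^[n] P) (sigmaPoint^[n] p)
      ((fun C : VariableChange (RatFunc k) =>
        C.map (sigmaField k : RatFunc k →+* RatFunc k))^[n] C) Q := by
  induction n with
  | zero => exact h
  | succ n ih =>
    rw [Function.iterate_succ_apply', Function.iterate_succ_apply', Function.iterate_succ_apply']
    exact ih.sigma

theorem HasCoords.frobenius [Fintype k] {W : WeierstrassCurve (RatFunc k)}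
    {P : WeierstrassModel W L} {p : OnePoint L}
    {C : VariableChange (RatFunc k)} {Q : Option (L × L)} (h : HasCoords P p C Q) :
    HasCoords (EllipticSurface.frobenius W P) (p.map (FiniteField.frobeniusAlgHom k L)) C
      (Q.map fun P => (P.1 ^ Fintype.card k, P.2 ^ Fintype.card k)) := by
  obtain ⟨hC, hQ, rfl⟩ := h
  exact ⟨_, (LocalPoint.transport (compatible_map (FiniteField.frobeniusAlgHom k L) p) W.map_id
    { change := C, minimal := hC, point := Q, equation := hQ }).equation, rfl⟩

end Representatives

/-! ### Coordinates on the base change -/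

section BaseChangeCoordinates

open WeierstrassCurve

variable {k : Type*} [Field k] {L : Type*} [Field L] [Algebra k L]

theorem isUnit_two_or_perfect [Fintype k] (p : OnePoint k) :
    IsUnit (2 : localRing k p) ∨ (2 : localRing k p) = 0 ∧ ∀ c : k, ∃ d, d ^ 2 = c := by
  by_cases h2 : (2 : k) = 0
  · refine Or.inr ⟨?_, fun c => ?_⟩
    · apply Subtype.ext
      change (2 : RatFunc k) = 0
      rw [← map_ofNat RatFunc.C 2, h2, map_zero]
    · have hchar : CharP k 2 := CharTwo.of_one_ne_zero_of_two_eq_zero one_ne_zero h2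
      obtain ⟨d, rfl⟩ := FiniteField.isSquare_of_char_two (ringChar.eq k 2) c
      exact ⟨d, sq d⟩
  · exact Or.inl (isUnit_algebraMap_localRing p h2 2 (by rw [map_ofNat]; rfl))

/-- The ring homomorphism `f ↦ f ∘ φ` of function fields. -/
noncomputable def phiHom (k : Type*) [Field k] [NeZero (3 : k)] : RatFunc k →+* RatFunc k :=
  subst (phiFun k) phiFun_ne_C

theorem variableChange_cubicBaseChange [NeZero (3 : k)] (W : WeierstrassCurve (RatFunc k))
    (C : VariableChange (RatFunc k)) :
    C.map (phiHom k) • cubicBaseChange W = (C • W).map (phiHom k) :=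
  map_variableChange W C (phiHom k)

instance [NeZero (3 : k)] (W : WeierstrassCurve (RatFunc k)) [W.IsElliptic] :
    (cubicBaseChange W).IsElliptic :=
  inferInstanceAs (W.map (phiHom k)).IsElliptic

theorem sigmaField_phiHom [NeZero (3 : k)] (f : RatFunc k) :
    sigmaField k (phiHom k f) = phiHom k f := by
  have : (sigmaField k).toAlgHom.comp (subst (phiFun k) phiFun_ne_C) =
      subst (phiFun k) phiFun_ne_C := by
    apply algHom_ext_X
    change sigmaField k (subst (phiFun k) phiFun_ne_C RatFunc.X) = _
    rw [subst_X, sigmaField_phiFun]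
  exact congrArg (fun e => e f) this

theorem map_sigmaField_iterate [NeZero (3 : k)] (C : VariableChange (RatFunc k)) (n : ℕ) :
    (fun C : VariableChange (RatFunc k) => C.map (sigmaField k : RatFunc k →+* RatFunc k))^[n]
      (C.map (phiHom k)) = C.map (phiHom k) := by
  apply Function.iterate_fixed
  ext <;> exact sigmaField_phiHom _

theorem mem_range_of_pow_card [Fintype k] {x : L} (hx : x ^ Fintype.card k = x) :
    ∃ c : k, algebraMap k L c = x := by
  have h := Polynomial.prod_multiset_X_sub_C_of_monic_of_roots_card_eq
    (p := (Polynomial.X ^ Fintype.card k - Polynomial.X : k[X]))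
    (Polynomial.monic_X_pow_sub (by
      rw [Polynomial.degree_X]; exact_mod_cast Fintype.one_lt_card))
    (by rw [FiniteField.roots_X_pow_card_sub_X,
      FiniteField.X_pow_card_sub_X_natDegree_eq k Fintype.one_lt_card]; rfl)
  have h0 := congrArg (Polynomial.aeval x) h
  rw [FiniteField.roots_X_pow_card_sub_X, map_multiset_prod, map_sub, map_pow,
    Polynomial.aeval_X, hx, sub_self, Multiset.prod_eq_zero_iff] at h0
  simp only [Multiset.map_map, Multiset.mem_map] at h0
  obtain ⟨c, -, hc⟩ := h0
  refine ⟨c, ?_⟩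
  simp only [Function.comp_apply, map_sub, Polynomial.aeval_X, Polynomial.aeval_C] at hc
  exact (sub_eq_zero.mp hc).symm

theorem exists_map_eq_of_frobenius [Fintype k] {Q : Option (L × L)}
    (hQ : (Q.map fun P => (P.1 ^ Fintype.card k, P.2 ^ Fintype.card k)) = Q) :
    ∃ Q₀ : Option (k × k), Q₀.map (Prod.map (algebraMap k L) (algebraMap k L)) = Q := by
  rcases Q with _ | ⟨x, y⟩
  · exact ⟨none, rfl⟩
  · simp only [Option.map_some, Option.some.injEq, Prod.mk.injEq] at hQ
    obtain ⟨a, rfl⟩ := mem_range_of_pow_card hQ.1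
    obtain ⟨b, rfl⟩ := mem_range_of_pow_card hQ.2
    exact ⟨some (a, b), rfl⟩

theorem frobenius_map_eq [Fintype k] (Q₀ : Option (k × k)) :
    ((Q₀.map (Prod.map (algebraMap k L) (algebraMap k L))).map
      fun P => (P.1 ^ Fintype.card k, P.2 ^ Fintype.card k)) =
      Q₀.map (Prod.map (algebraMap k L) (algebraMap k L)) := by
  rcases Q₀ with _ | ⟨x, y⟩
  · rfl
  · simp [← map_pow, FiniteField.pow_card]

theorem equation_map_iff {V : WeierstrassCurve k} {Q₀ : Option (k × k)} :
    (∀ P ∈ Q₀.map (Prod.map (algebraMap k L) (algebraMap k L)),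
      (V.map (algebraMap k L)).toAffine.Equation P.1 P.2) ↔
      ∀ P ∈ Q₀, V.toAffine.Equation P.1 P.2 := by
  rcases Q₀ with _ | ⟨x, y⟩
  · simp
  · simpa using Affine.map_equation V (algebraMap k L).injective x y

variable [Algebra.IsAlgebraic k L]

/-- Above an unramified point, the pull-back of a minimal equation is minimal. -/
theorem isMinimal_cubicBaseChange [Fintype k] [NeZero (3 : k)] {W : WeierstrassCurve (RatFunc k)}
    [W.IsElliptic] {s : OnePoint L} (hs : IsUnramifiedPoint s) {t : OnePoint k}
    (hst : phiPoint s = t.map (Algebra.ofId k L)) {C : VariableChange (RatFunc k)}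
    (hC : IsMinimal (localRing k t) (C • W)) :
    IsMinimal (localRing k s) (C.map (phiHom k) • cubicBaseChange W) := by
  obtain ⟨f, π, hf, H⟩ := exists_isUnramifiedAt_phi hs hst
  rw [variableChange_cubicBaseChange]
  exact H.isMinimal_map (phiHom k) hf (isUnit_three_localRing t) (isUnit_two_or_perfect t)
    (C • W).isUnit_Δ.ne_zero hC

theorem reducedCurve_cubicBaseChange [Fintype k] [NeZero (3 : k)]
    {W : WeierstrassCurve (RatFunc k)}
    {s : OnePoint L} (hs : IsUnramifiedPoint s) {t : OnePoint k}
    (hst : phiPoint s = t.map (Algebra.ofId k L)) {C : VariableChange (RatFunc k)}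
    [hC : IsMinimal (localRing k t) (C • W)]
    [hC' : IsMinimal (localRing k s) (C.map (phiHom k) • cubicBaseChange W)] :
    reducedCurve (C.map (phiHom k) • cubicBaseChange W) s =
      (reducedCurve (C • W) t).map (algebraMap k L) := by
  obtain ⟨f, π, hf, H⟩ := exists_isUnramifiedAt_phi hs hst
  have key : ∀ (a : localRing k t) (b : localRing k s), (b : RatFunc k) = phiHom k a →
      evalAt k s b = algebraMap k L (evalAt k t a) := by
    intro a b h
    rw [← H.comp_eq a]
    congr 1
    exact Subtype.ext (h.trans (hf a))
  have hmap := variableChange_cubicBaseChange W C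
  ext
  · exact key _ _ ((integralModel_a₁_eq (localRing k s) _).trans ((congrArg _ hmap).trans
      (congrArg (phiHom k) (integralModel_a₁_eq (localRing k t) (C • W)).symm)))
  · exact key _ _ ((integralModel_a₂_eq (localRing k s) _).trans ((congrArg _ hmap).trans
      (congrArg (phiHom k) (integralModel_a₂_eq (localRing k t) (C • W)).symm)))
  · exact key _ _ ((integralModel_a₃_eq (localRing k s) _).trans ((congrArg _ hmap).trans
      (congrArg (phiHom k) (integralModel_a₃_eq (localRing k t) (C • W)).symm)))
  · exact key _ _ ((integralModel_a₄_eq (localRing k s) _).trans ((congrArg _ hmap).trans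
      (congrArg (phiHom k) (integralModel_a₄_eq (localRing k t) (C • W)).symm)))
  · exact key _ _ ((integralModel_a₆_eq (localRing k s) _).trans ((congrArg _ hmap).trans
      (congrArg (phiHom k) (integralModel_a₆_eq (localRing k t) (C • W)).symm)))

end BaseChangeCoordinates

/-! ### Fixed points in a fibre -/

section TwistedFrobenius

open WeierstrassCurve

/-- The Frobenius map agrees with an affine change of coordinates at finitely many points. -/
theorem finite_frobenius_eq_changeCoord {L : Type*} [Field L] {q : ℕ} (hq : 1 < q)
    (D : VariableChange L) :
    {Q : Option (L × L) | (Q.map fun P => (P.1 ^ q, P.2 ^ q)) = changeCoord D Q}.Finite := by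
  have hfin : ∀ a b : L, {x : L | x ^ q = a * x + b}.Finite := by
    intro a b
    have hm : (Polynomial.X ^ q - (Polynomial.C a * Polynomial.X + Polynomial.C b)).Monic :=
      Polynomial.monic_X_pow_sub ((Polynomial.degree_linear_le).trans_lt (by exact_mod_cast hq))
    refine (Polynomial.finite_setOfPred_isRoot hm.ne_zero).subset fun x hx => ?_
    simp only [Set.mem_ofPred_eq, Polynomial.IsRoot.def] at hx ⊢
    simp [hx]
  refine ((((hfin (D.u ^ 2) D.r).biUnion fun x _ =>
    ((hfin (D.u ^ 3) (D.u ^ 2 * D.s * x + D.t)).image fun y => some (x, y))).insert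
      none)).subset ?_
  rintro (_ | ⟨x, y⟩) h
  · exact Set.mem_insert _ _
  · simp only [Set.mem_ofPred_eq, changeCoord, Option.map_some, Option.some.injEq,
      Prod.mk.injEq] at h
    refine Set.mem_insert_of_mem _ (Set.mem_biUnion h.1 ⟨y, ?_, rfl⟩)
    simp only [Set.mem_ofPred_eq, h.2]
    ring

variable {k : Type*} [Field k] [Fintype k] [NeZero (3 : k)] {W : WeierstrassCurve (RatFunc k)}

/-- The map induced by `twistedFrobenius` on the projective line. -/
noncomputable def twistedFrobeniusPoint (k : Type*) [Field k] [Fintype k] (i : Fin 3)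
    (p : OnePoint (AlgebraicClosure k)) : OnePoint (AlgebraicClosure k) :=
  (sigmaPoint^[i] p).map (FiniteField.frobeniusAlgHom k (AlgebraicClosure k))

theorem HasCoords.twistedFrobenius (i : Fin 3)
    {P : WeierstrassModel (cubicBaseChange W) (AlgebraicClosure k)}
    {p : OnePoint (AlgebraicClosure k)} {C : VariableChange (RatFunc k)}
    {Q : Option (AlgebraicClosure k × AlgebraicClosure k)} (h : HasCoords P p C Q) :
    HasCoords (twistedFrobenius W i P) (twistedFrobeniusPoint k i p)
      ((fun C : VariableChange (RatFunc k) =>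
        C.map (sigmaField k : RatFunc k →+* RatFunc k))^[i] C)
      (Q.map fun P => (P.1 ^ Fintype.card k, P.2 ^ Fintype.card k)) :=
  (h.sigma_iterate i).frobenius

variable [W.IsElliptic]

theorem twistedFrobeniusPoint_eq_of_fixed {i : Fin 3}
    {P : WeierstrassModel (cubicBaseChange W) (AlgebraicClosure k)}
    (h : twistedFrobenius W i P = P) : twistedFrobeniusPoint k i P.1 = P.1 := by
  obtain ⟨C, hC⟩ := exists_isMinimal (localRing k P.1) (cubicBaseChange W)
  obtain ⟨Q, hQ⟩ := exists_hasCoords P hC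
  rw [← (hQ.twistedFrobenius i).fst_eq, h]

theorem finite_fixed_fibre (i : Fin 3) (p : OnePoint (AlgebraicClosure k)) :
    {P : WeierstrassModel (cubicBaseChange W) (AlgebraicClosure k) |
      twistedFrobenius W i P = P ∧ P.1 = p}.Finite := by
  obtain ⟨C, hC⟩ := exists_isMinimal (localRing k p) (cubicBaseChange W)
  obtain ⟨D, -, hD⟩ := HasCoords.exists_change (W := cubicBaseChange W) p C
    ((fun C : VariableChange (RatFunc k) =>
      C.map (sigmaField k : RatFunc k →+* RatFunc k))^[i] C)
  refine ((finite_frobenius_eq_changeCoord (q := Fintype.card k) Fintype.one_lt_card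
    (D.map (evalAt k p))).biUnion (t := fun Q => {P | HasCoords P p C Q}) fun Q _ => ?_).subset ?_
  · exact Set.Subsingleton.finite fun P hP P' hP' => HasCoords.eq hP hP'
  · rintro P ⟨hP, rfl⟩
    obtain ⟨Q, hQ⟩ := exists_hasCoords P hC
    have h := hQ.twistedFrobenius i
    rw [hP, twistedFrobeniusPoint_eq_of_fixed hP] at h
    exact Set.mem_biUnion (hD hQ h) hQ

/-- Above an unramified fixed point `s` with `φ(s) = t`, the fixed points are the points with
coordinates in `k` in the pull-back of an equation that is minimal at `t`. -/
theorem fixed_iff_exists_hasCoords {i : Fin 3} {s : OnePoint (AlgebraicClosure k)}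
    (hs : IsUnramifiedPoint s) (hsi : twistedFrobeniusPoint k i s = s) {t : OnePoint k}
    (hst : phiPoint s = t.map (Algebra.ofId k (AlgebraicClosure k)))
    {C : VariableChange (RatFunc k)} [hC : IsMinimal (localRing k t) (C • W)]
    {P : WeierstrassModel (cubicBaseChange W) (AlgebraicClosure k)} :
    twistedFrobenius W i P = P ∧ P.1 = s ↔
      ∃ Q : {Q : Option (k × k) //
        ∀ P ∈ Q, (reducedCurve (C • W) t).toAffine.Equation P.1 P.2},
        HasCoords P s (C.map (phiHom k)) (Q.1.map (Prod.map (algebraMap k (AlgebraicClosure k))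
          (algebraMap k (AlgebraicClosure k)))) := by
  have hC' := isMinimal_cubicBaseChange hs hst hC
  constructor
  · rintro ⟨hP, rfl⟩
    obtain ⟨Q, hQ⟩ := exists_hasCoords P hC'
    have h := hQ.twistedFrobenius i
    rw [hP, hsi, map_sigmaField_iterate] at h
    obtain ⟨Q₀, rfl⟩ := exists_map_eq_of_frobenius (h.coords_eq hQ)
    refine ⟨⟨Q₀, ?_⟩, hQ⟩
    obtain ⟨_, hQ', -⟩ := hQ
    rw [reducedCurve_cubicBaseChange hs hst] at hQ'
    exact equation_map_iff.mp hQ'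
  · rintro ⟨Q, hQ⟩
    have h := hQ.twistedFrobenius i
    rw [hsi, map_sigmaField_iterate, frobenius_map_eq] at h
    exact ⟨h.eq hQ, hQ.fst_eq⟩

end TwistedFrobenius

/-! ### The fibres of the cubic cover -/

section CubicCover

variable {L : Type*} [Field L]

theorem sigmaPoint_infty : sigmaPoint (∞ : OnePoint L) = ((1 : L) : OnePoint L) := rfl

theorem sigmaPoint_zero : sigmaPoint ((0 : L) : OnePoint L) = ∞ := by simp [sigmaPoint]

theorem sigmaPoint_coe {x : L} (hx : x ≠ 0) :
    sigmaPoint (x : OnePoint L) = (((x - 1) / x : L) : OnePoint L) := by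
  simp [sigmaPoint, hx]

theorem sigmaPoint_one : sigmaPoint ((1 : L) : OnePoint L) = ((0 : L) : OnePoint L) := by
  simp [sigmaPoint_coe one_ne_zero]

theorem sigmaPoint_map {L' : Type*} [Field L'] (τ : L →+* L') (p : OnePoint L) :
    sigmaPoint (p.map τ) = (sigmaPoint p).map τ := by
  induction p using OnePoint.rec with
  | infty => simp [sigmaPoint_infty]
  | coe x =>
    by_cases h0 : x = 0
    · simp [h0, sigmaPoint_zero]
    · rw [OnePoint.map_some, sigmaPoint_coe h0, sigmaPoint_coe (by simpa using h0)]
      simp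

theorem phiPoint_map {L' : Type*} [Field L'] (τ : L →+* L') (p : OnePoint L) :
    phiPoint (p.map τ) = (phiPoint p).map τ := by
  induction p using OnePoint.rec with
  | infty => simp [phiPoint_infty]
  | coe x =>
    by_cases h0 : x = 0
    · simp [h0, phiPoint_zero]
    by_cases h1 : x = 1
    · simp [h1, phiPoint_one]
    · rw [OnePoint.map_some, phiPoint_coe h0 h1, phiPoint_coe (by simpa using h0)
        (by rwa [← map_one τ, Ne, τ.injective.eq_iff])]
      simp [map_ofNat]

theorem phiPoint_eq_coe_iff (h3 : (3 : L) ≠ 0) {p : OnePoint L} {t : L} :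
    phiPoint p = (t : OnePoint L) ↔
      ∃ x : L, p = x ∧ x ^ 3 - 3 * (t + 1) * x ^ 2 + 3 * t * x + 1 = 0 := by
  induction p using OnePoint.rec with
  | infty => simp [phiPoint_infty]
  | coe x =>
    simp only [OnePoint.coe_eq_coe, exists_eq_left']
    by_cases h0 : x = 0
    · simp [h0, phiPoint_zero]
    by_cases h1 : x = 1
    · subst h1
      simp only [phiPoint_one, OnePoint.infty_ne_coe, false_iff]
      intro h
      apply one_ne_zero (α := L)
      linear_combination -h
    · have hb : 3 * x ^ 2 - 3 * x ≠ 0 := by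
        have : 3 * x ^ 2 - 3 * x = 3 * x * (x - 1) := by ring
        rw [this]
        exact mul_ne_zero (mul_ne_zero h3 h0) (sub_ne_zero.mpr h1)
      rw [phiPoint_coe h0 h1, OnePoint.coe_eq_coe, div_eq_iff hb]
      constructor <;> intro h <;> linear_combination h

theorem phiPoint_eq_infty_iff {p : OnePoint L} :
    phiPoint p = ∞ ↔ p = ∞ ∨ p = ((1 : L) : OnePoint L) ∨ p = ((0 : L) : OnePoint L) := by
  induction p using OnePoint.rec with
  | infty => simp [phiPoint_infty]
  | coe x =>
    by_cases h0 : x = 0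
    · simp [h0, phiPoint_zero]
    by_cases h1 : x = 1
    · simp [h1, phiPoint_one]
    · simp [phiPoint_coe h0 h1, h0, h1]

theorem phiPoint_sigmaPoint (p : OnePoint L) : phiPoint (sigmaPoint p) = phiPoint p := by
  induction p using OnePoint.rec with
  | infty => simp [sigmaPoint_infty, phiPoint_one, phiPoint_infty]
  | coe x =>
    by_cases h0 : x = 0
    · simp [h0, sigmaPoint_zero, phiPoint_infty, phiPoint_zero]
    by_cases h1 : x = 1
    · simp [h1, sigmaPoint_one, phiPoint_one, phiPoint_zero]
    · have h1' : x - 1 ≠ 0 := sub_ne_zero.mpr h1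
      rw [sigmaPoint_coe h0, phiPoint_coe h0 h1, phiPoint_coe (div_ne_zero h1' h0)
        (by rw [Ne, div_eq_one_iff_eq h0, sub_eq_self]; exact one_ne_zero), OnePoint.coe_eq_coe]
      have e1 : ((x - 1) / x) ^ 3 - 3 * ((x - 1) / x) ^ 2 + 1 =
          -(x ^ 3 - 3 * x ^ 2 + 1) / x ^ 3 := by field_simp; ring
      have e2 : 3 * ((x - 1) / x) ^ 2 - 3 * ((x - 1) / x) = -(3 * x ^ 2 - 3 * x) / x ^ 3 := by
        field_simp; ring
      rw [e1, e2, div_div_div_cancel_right₀ (pow_ne_zero 3 h0), neg_div_neg_eq]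

theorem phiPoint_sigmaPoint_iterate (n : ℕ) (p : OnePoint L) :
    phiPoint (sigmaPoint^[n] p) = phiPoint p := by
  induction n with
  | zero => rfl
  | succ n ih => rw [Function.iterate_succ_apply', phiPoint_sigmaPoint, ih]

/-- Vieta's formulas: with `x` also `σ(x)` and `σ²(x)` are roots of the cubic polynomial of a
fibre. -/
theorem cubic_factor {x t : L} (h0 : x ≠ 0) (h1 : x ≠ 1)
    (hx : x ^ 3 - 3 * (t + 1) * x ^ 2 + 3 * t * x + 1 = 0) :
    x + (x - 1) / x + -1 / (x - 1) = 3 * (t + 1) ∧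
      x * ((x - 1) / x) + x * (-1 / (x - 1)) + (x - 1) / x * (-1 / (x - 1)) = 3 * t ∧
      x * ((x - 1) / x) * (-1 / (x - 1)) = -1 := by
  have h1' : x - 1 ≠ 0 := sub_ne_zero.mpr h1
  refine ⟨?_, ?_, ?_⟩
  · field_simp
    linear_combination hx
  · field_simp
    linear_combination hx
  · field_simp

theorem sigmaPoint_sigmaPoint_coe {x : L} (h0 : x ≠ 0) (h1 : x ≠ 1) :
    sigmaPoint (sigmaPoint (x : OnePoint L)) = ((-1 / (x - 1) : L) : OnePoint L) := by
  have h1' : x - 1 ≠ 0 := sub_ne_zero.mpr h1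
  rw [sigmaPoint_coe h0, sigmaPoint_coe (div_ne_zero h1' h0), OnePoint.coe_eq_coe]
  field_simp
  ring

/-- The fibres of `φ` are the orbits of `σ`. -/
theorem eq_or_eq_or_eq_of_phiPoint_eq (h3 : (3 : L) ≠ 0) {p q : OnePoint L}
    (h : phiPoint q = phiPoint p) :
    q = p ∨ q = sigmaPoint p ∨ q = sigmaPoint (sigmaPoint p) := by
  rcases hT : phiPoint p with _ | t
  · change phiPoint p = ∞ at hT
    rw [hT, phiPoint_eq_infty_iff] at h
    rw [phiPoint_eq_infty_iff] at hT
    rcases hT with rfl | rfl | rfl <;>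
      simp only [sigmaPoint_infty, sigmaPoint_one, sigmaPoint_zero] <;> tauto
  · change phiPoint p = (t : OnePoint L) at hT
    rw [hT] at h
    obtain ⟨x, rfl, hx⟩ := (phiPoint_eq_coe_iff h3).mp hT
    obtain ⟨y, rfl, hy⟩ := (phiPoint_eq_coe_iff h3).mp h
    have h0 : x ≠ 0 := by rintro rfl; simp at hx
    have h1 : x ≠ 1 := by
      rintro rfl
      apply one_ne_zero (α := L)
      linear_combination -hx
    obtain ⟨e1, e2, e3⟩ := cubic_factor h0 h1 hx
    have : (y - x) * ((y - (x - 1) / x) * (y - -1 / (x - 1))) = 0 := by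
      linear_combination hy - y ^ 2 * e1 + y * e2 - e3
    rw [sigmaPoint_sigmaPoint_coe h0 h1, sigmaPoint_coe h0]
    simp only [OnePoint.coe_eq_coe]
    rcases mul_eq_zero.mp this with h | h
    · exact Or.inl (sub_eq_zero.mp h)
    · rcases mul_eq_zero.mp h with h | h
      · exact Or.inr (Or.inl (sub_eq_zero.mp h))
      · exact Or.inr (Or.inr (sub_eq_zero.mp h))

theorem IsUnramifiedPoint.sigmaPoint_ne {p : OnePoint L} (hp : IsUnramifiedPoint p) :
    sigmaPoint p ≠ p := by
  induction p using OnePoint.rec with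
  | infty => simp [sigmaPoint_infty]
  | coe x =>
    by_cases h0 : x = 0
    · simp [h0, sigmaPoint_zero]
    · rw [sigmaPoint_coe h0, Ne, OnePoint.coe_eq_coe, div_eq_iff h0]
      intro h
      exact hp x rfl (by linear_combination -h)

theorem IsUnramifiedPoint.sigmaPoint_sigmaPoint_ne {p : OnePoint L} (hp : IsUnramifiedPoint p) :
    sigmaPoint (sigmaPoint p) ≠ p := by
  intro h
  apply hp.sigmaPoint_ne
  conv_rhs => rw [← sigmaPoint_sigmaPoint_sigmaPoint p]
  rw [h]

theorem IsUnramifiedPoint.sigmaPoint_sigmaPoint_ne_sigmaPoint {p : OnePoint L}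
    (hp : IsUnramifiedPoint p) : sigmaPoint (sigmaPoint p) ≠ sigmaPoint p := by
  intro h
  apply hp.sigmaPoint_ne
  have := congrArg (fun q => sigmaPoint (sigmaPoint q)) h
  simp only [sigmaPoint_sigmaPoint_sigmaPoint] at this
  exact this

theorem surjective_phiPoint (h3 : (3 : L) ≠ 0) [IsAlgClosed L] (T : OnePoint L) :
    ∃ p, phiPoint p = T := by
  induction T using OnePoint.rec with
  | infty => exact ⟨∞, phiPoint_infty⟩
  | coe t =>
    have hd : (Polynomial.X ^ 3 - Polynomial.C (3 * (t + 1)) * Polynomial.X ^ 2 +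
        Polynomial.C (3 * t) * Polynomial.X + 1 : L[X]).degree = 3 := by compute_degree!
    obtain ⟨x, hx⟩ := IsAlgClosed.exists_root _ (by rw [hd]; norm_num)
    exact ⟨x, (phiPoint_eq_coe_iff h3).mpr ⟨x, rfl, by simpa using hx⟩⟩

/-- The ramification points lie above the points `w` with `w² + w + 1 = 0`. -/
theorem isUnramifiedPoint_iff (h3 : (3 : L) ≠ 0) {p : OnePoint L} :
    IsUnramifiedPoint p ↔ ∀ w : L, phiPoint p = w → w ^ 2 + w + 1 ≠ 0 := by
  constructor
  · rintro hp w hw h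
    obtain ⟨x, rfl, hx⟩ := (phiPoint_eq_coe_iff h3).mp hw
    -- the cubic polynomial is the third power of `X - (w + 1)`
    have : (x - (w + 1)) ^ 3 = 0 := by
      linear_combination hx + (3 * x - w - 2) * h
    have hx' : x = w + 1 := sub_eq_zero.mp (pow_eq_zero_iff three_ne_zero |>.mp this)
    exact hp x rfl (by rw [hx']; linear_combination h)
  · rintro hp x rfl hx
    refine hp (x - 1) ((phiPoint_eq_coe_iff h3).mpr ⟨x, rfl, ?_⟩) ?_
    · linear_combination (1 - 2 * x) * hx
    · linear_combination hx

theorem ncard_phiPoint_fibre (h3 : (3 : L) ≠ 0) [IsAlgClosed L] {T : OnePoint L}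
    (hT : ∀ w : L, T = w → w ^ 2 + w + 1 ≠ 0) : {p | phiPoint p = T}.ncard = 3 := by
  obtain ⟨p, rfl⟩ := surjective_phiPoint h3 T
  have hp := (isUnramifiedPoint_iff h3).mpr hT
  rw [Set.ncard_eq_three]
  refine ⟨p, sigmaPoint p, sigmaPoint (sigmaPoint p), hp.sigmaPoint_ne.symm,
    hp.sigmaPoint_sigmaPoint_ne.symm, hp.sigmaPoint_sigmaPoint_ne_sigmaPoint.symm, ?_⟩
  ext q
  constructor
  · exact fun h => eq_or_eq_or_eq_of_phiPoint_eq h3 h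
  · rintro (rfl | rfl | rfl) <;> simp [phiPoint_sigmaPoint]

theorem finite_phiPoint_fibre (h3 : (3 : L) ≠ 0) [IsAlgClosed L] (T : OnePoint L) :
    {p | phiPoint p = T}.Finite := by
  obtain ⟨p, rfl⟩ := surjective_phiPoint h3 T
  exact (Set.toFinite {p, sigmaPoint p, sigmaPoint (sigmaPoint p)}).subset
    fun q hq => eq_or_eq_or_eq_of_phiPoint_eq h3 hq

theorem primitiveRoot_iff {ζ : L} (hζ : IsPrimitiveRoot ζ 3) {w : L} :
    w ^ 2 + w + 1 = 0 ↔ w = ζ ∨ w = ζ ^ 2 := by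
  have h := hζ.geom_sum_eq_zero (by norm_num)
  simp only [Finset.sum_range_succ, Finset.sum_range_zero, pow_zero, pow_one, zero_add] at h
  have h3 := hζ.pow_eq_one
  have : w ^ 2 + w + 1 = (w - ζ) * (w - ζ ^ 2) := by linear_combination w * h - h3
  rw [this, mul_eq_zero, sub_eq_zero, sub_eq_zero]

theorem not_isUnramifiedPoint_iff {ζ : L} (hζ : IsPrimitiveRoot ζ 3)
    (p : OnePoint (L)) : ¬ IsUnramifiedPoint p ↔
      p = ((-ζ : L) : OnePoint (L)) ∨
        p = ((-ζ ^ 2 : L) : OnePoint (L)) := by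
  have key : ∀ x : L, x ^ 2 - x + 1 = 0 ↔ x = -ζ ∨ x = -ζ ^ 2 := by
    intro x
    rw [← neg_eq_iff_eq_neg, ← neg_eq_iff_eq_neg, ← primitiveRoot_iff hζ]
    ring_nf
  simp only [IsUnramifiedPoint, not_forall, not_not, key]
  constructor
  · rintro ⟨x, rfl, rfl | rfl⟩
    · exact Or.inl rfl
    · exact Or.inr rfl
  · rintro (rfl | rfl)
    · exact ⟨_, rfl, Or.inl rfl⟩
    · exact ⟨_, rfl, Or.inr rfl⟩

end CubicCover

/-! ### The sets `K^{(i)}` in terms of the Frobenius map -/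

section KSets

variable {k : Type*} [Field k]

/-- A rational point of the projective line as a geometric point. -/
noncomputable def geometricPoint (t : OnePoint k) : OnePoint (AlgebraicClosure k) :=
  t.map (Algebra.ofId k (AlgebraicClosure k))

theorem geometricPoint_coe (t : k) : geometricPoint (t : OnePoint k) =
    ((algebraMap k (AlgebraicClosure k) t : AlgebraicClosure k) :
      OnePoint (AlgebraicClosure k)) := rfl

theorem geometricPoint_injective :
    Function.Injective (geometricPoint : OnePoint k → OnePoint (AlgebraicClosure k)) :=
  Option.map_injective (algebraMap k (AlgebraicClosure k)).injective

theorem map_fibreCubic (t : k) :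
    (fibreCubic t).map (algebraMap k (AlgebraicClosure k)) =
      Polynomial.X ^ 3 - Polynomial.C (3 * (algebraMap k (AlgebraicClosure k) t + 1)) *
        Polynomial.X ^ 2 + Polynomial.C (3 * algebraMap k (AlgebraicClosure k) t) *
          Polynomial.X + 1 := by
  simp [fibreCubic, map_ofNat (algebraMap k (AlgebraicClosure k)) 3]

/-- Above an unramified finite point, the cubic polynomial is separable, with roots `s`, `σ(s)` and
`σ²(s)`; so divisibility can be tested at the roots. -/
theorem fibreCubic_dvd_iff [NeZero (3 : k)] {s : OnePoint (AlgebraicClosure k)}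
    (hs : IsUnramifiedPoint s) {t : k} (hst : phiPoint s = geometricPoint (t : OnePoint k))
    {f : k[X]} : fibreCubic t ∣ f ↔ ∀ x : AlgebraicClosure k,
      (s = x ∨ sigmaPoint s = x ∨ sigmaPoint (sigmaPoint s) = x) → Polynomial.aeval x f = 0 := by
  have h3 : (3 : AlgebraicClosure k) ≠ 0 := three_ne_zero_of_algebra k
  rw [geometricPoint_coe, phiPoint_eq_coe_iff h3] at hst
  obtain ⟨x, rfl, hx⟩ := hst
  have h0 : x ≠ 0 := by rintro rfl; simp at hx
  have h1 : x ≠ 1 := by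
    rintro rfl
    apply one_ne_zero (α := AlgebraicClosure k)
    linear_combination -hx
  obtain ⟨e1, e2, e3⟩ := cubic_factor h0 h1 hx
  have n1 := hs.sigmaPoint_ne
  have n2 := hs.sigmaPoint_sigmaPoint_ne
  have n3 := hs.sigmaPoint_sigmaPoint_ne_sigmaPoint
  rw [sigmaPoint_sigmaPoint_coe h0 h1] at n2 n3 ⊢
  rw [sigmaPoint_coe h0] at n1 n3 ⊢
  simp only [ne_eq, OnePoint.coe_eq_coe] at n1 n2 n3 ⊢
  generalize (x - 1) / x = y at *
  generalize -1 / (x - 1) = z at *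
  have hprod : (fibreCubic t).map (algebraMap k (AlgebraicClosure k)) =
      (Polynomial.X - Polynomial.C x) * ((Polynomial.X - Polynomial.C y) *
        (Polynomial.X - Polynomial.C z)) := by
    have c1 := congrArg Polynomial.C e1
    have c2 := congrArg Polynomial.C e2
    have c3 := congrArg Polynomial.C e3
    rw [map_fibreCubic, ← c1, ← c2]
    simp only [map_add, map_mul, map_neg, map_one] at c3 ⊢
    linear_combination c3
  have hcop : ∀ a b : AlgebraicClosure k, ¬ a = b →
      IsCoprime (Polynomial.X - Polynomial.C a) (Polynomial.X - Polynomial.C b) := fun a b hab =>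
    Polynomial.isCoprime_X_sub_C_of_isUnit_sub (sub_ne_zero.mpr hab).isUnit
  have hroot : ∀ a : AlgebraicClosure k, Polynomial.X - Polynomial.C a ∣
      f.map (algebraMap k (AlgebraicClosure k)) ↔ Polynomial.aeval a f = 0 := by
    intro a
    rw [Polynomial.dvd_iff_isRoot, Polynomial.IsRoot.def, Polynomial.eval_map_algebraMap]
  rw [← Polynomial.map_dvd_map' (algebraMap k (AlgebraicClosure k)), hprod]
  constructor
  · rintro h w (rfl | rfl | rfl)
    · exact (hroot _).mp ((Dvd.intro _ rfl).trans h)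
    · exact (hroot _).mp (((Dvd.intro _ rfl).trans (Dvd.intro_left _ rfl)).trans h)
    · exact (hroot _).mp (((Dvd.intro_left _ rfl).trans (Dvd.intro_left _ rfl)).trans h)
  · intro h
    refine IsCoprime.mul_dvd ((hcop x y (Ne.symm n1)).mul_right (hcop x z (Ne.symm n2)))
      ((hroot _).mpr (h x (Or.inl rfl))) (IsCoprime.mul_dvd (hcop y z (Ne.symm n3))
        ((hroot _).mpr (h y (Or.inr (Or.inl rfl)))) ((hroot _).mpr (h z (Or.inr (Or.inr rfl)))))

variable [Fintype k]

/-- The Frobenius map on the geometric points of the projective line. -/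
noncomputable def frobeniusPoint (k : Type*) [Field k] [Fintype k]
    (p : OnePoint (AlgebraicClosure k)) : OnePoint (AlgebraicClosure k) :=
  p.map (FiniteField.frobeniusAlgHom k (AlgebraicClosure k) :
    AlgebraicClosure k →+* AlgebraicClosure k)

theorem frobeniusPoint_coe (x : AlgebraicClosure k) :
    frobeniusPoint k (x : OnePoint (AlgebraicClosure k)) =
      ((x ^ Fintype.card k : AlgebraicClosure k) : OnePoint (AlgebraicClosure k)) := rfl

theorem frobeniusPoint_sigmaPoint (p : OnePoint (AlgebraicClosure k)) :
    frobeniusPoint k (sigmaPoint p) = sigmaPoint (frobeniusPoint k p) :=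
  (sigmaPoint_map _ p).symm

theorem frobeniusPoint_phiPoint (p : OnePoint (AlgebraicClosure k)) :
    frobeniusPoint k (phiPoint p) = phiPoint (frobeniusPoint k p) :=
  (phiPoint_map _ p).symm

theorem sigmaPoint_injective {L : Type*} [Field L] :
    Function.Injective (sigmaPoint : OnePoint L → OnePoint L) := fun p q h => by
  rw [← sigmaPoint_sigmaPoint_sigmaPoint p, h, sigmaPoint_sigmaPoint_sigmaPoint]

theorem frobeniusPoint_geometricPoint (t : OnePoint k) :
    frobeniusPoint k (geometricPoint t) = geometricPoint t := by
  induction t using OnePoint.rec with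
  | infty => rfl
  | coe t => rw [geometricPoint_coe, frobeniusPoint_coe, ← map_pow, FiniteField.pow_card]

theorem exists_geometricPoint_eq {p : OnePoint (AlgebraicClosure k)}
    (hp : frobeniusPoint k p = p) : ∃ t, geometricPoint t = p := by
  induction p using OnePoint.rec with
  | infty => exact ⟨∞, rfl⟩
  | coe x =>
    rw [frobeniusPoint_coe, OnePoint.coe_eq_coe] at hp
    obtain ⟨c, rfl⟩ := mem_range_of_pow_card hp
    exact ⟨c, rfl⟩

theorem twistedFrobeniusPoint_eq (i : Fin 3) (p : OnePoint (AlgebraicClosure k)) :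
    twistedFrobeniusPoint k i p = sigmaPoint^[i] (frobeniusPoint k p) := by
  have h : ∀ n : ℕ, frobeniusPoint k (sigmaPoint^[n] p) = sigmaPoint^[n] (frobeniusPoint k p) := by
    intro n
    induction n with
    | zero => rfl
    | succ n ih =>
      rw [Function.iterate_succ_apply', Function.iterate_succ_apply', frobeniusPoint_sigmaPoint, ih]
  exact h i

/-- If `Fr(σⁱ(s)) = s`, then `φ(s)` is a rational point. -/
theorem exists_geometricPoint_eq_phiPoint {i : Fin 3} {s : OnePoint (AlgebraicClosure k)}
    (hs : twistedFrobeniusPoint k i s = s) : ∃ t, phiPoint s = geometricPoint t := by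
  obtain ⟨t, ht⟩ := exists_geometricPoint_eq (p := phiPoint s) (by
    rw [twistedFrobeniusPoint_eq] at hs
    rw [frobeniusPoint_phiPoint, ← phiPoint_sigmaPoint_iterate i, hs])
  exact ⟨t, ht.symm⟩

theorem coe_mem_K0 {t : k} : (t : OnePoint k) ∈ K0 k ↔
    fibreCubic t ∣ Polynomial.X ^ Fintype.card k - Polynomial.X := by
  simp [K0]

theorem coe_mem_K2 {t : k} : (t : OnePoint k) ∈ K2 k ↔
    fibreCubic t ∣ Polynomial.X ^ (Fintype.card k + 1) - Polynomial.X + 1 := by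
  simp [K2]

theorem frobeniusPoint_of_phiPoint_eq_infty {s : OnePoint (AlgebraicClosure k)}
    (hs : phiPoint s = ∞) : frobeniusPoint k s = s := by
  rcases phiPoint_eq_infty_iff.mp hs with rfl | rfl | rfl
  · rfl
  · rw [frobeniusPoint_coe, one_pow]
  · rw [frobeniusPoint_coe, zero_pow Fintype.card_ne_zero]

/-- Over a branch point `t` the cubic polynomial is the third power of `X - (t + 1)`, whereas
`t + 1` is not a multiple root of `X ^ q - X` or of `X ^ (q + 1) - X + 1`. -/
theorem not_fibreCubic_dvd {t : k} (ht : t ^ 2 + t + 1 = 0) :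
    ¬ fibreCubic t ∣ Polynomial.X ^ Fintype.card k - Polynomial.X ∧
      ¬ fibreCubic t ∣ Polynomial.X ^ (Fintype.card k + 1) - Polynomial.X + 1 := by
  have hcube : fibreCubic t = (Polynomial.X - Polynomial.C (t + 1)) ^ 3 := by
    have hC := congrArg Polynomial.C ht
    simp only [fibreCubic, map_add, map_mul, map_pow, map_one, map_zero, map_ofNat] at hC ⊢
    linear_combination (-3 * Polynomial.X + Polynomial.C t + 2) * hC
  have hder : ∀ f : k[X], fibreCubic t ∣ f →
      f.eval (t + 1) = 0 ∧ f.derivative.eval (t + 1) = 0 := by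
    rintro f ⟨g, rfl⟩
    rw [hcube]
    simp [Polynomial.derivative_mul, Polynomial.derivative_pow]
  have hq : Polynomial.derivative (Polynomial.X ^ Fintype.card k : k[X]) = 0 := by
    rw [Polynomial.derivative_X_pow, FiniteField.cast_card_eq_zero k, map_zero, zero_mul]
  constructor <;> intro h
  · simpa [hq] using (hder _ h).2
  · obtain ⟨h1, h2⟩ := hder _ h
    simp only [pow_succ, Polynomial.derivative_add, Polynomial.derivative_sub,
      Polynomial.derivative_mul, hq, Polynomial.derivative_one, Polynomial.derivative_X,
      Polynomial.eval_add, Polynomial.eval_sub, Polynomial.eval_mul, Polynomial.eval_pow,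
      Polynomial.eval_X, Polynomial.eval_one, zero_mul, zero_add, mul_one, add_zero] at h1 h2
    have : (1 : k) = 0 := by linear_combination h1 - (t + 1) * h2
    exact one_ne_zero this

theorem ne_of_mem_K {ζ : AlgebraicClosure k} (hζ : IsPrimitiveRoot ζ 3) {i : Fin 3} {t : k}
    (ht : (t : OnePoint k) ∈ K k ζ i) :
    algebraMap k (AlgebraicClosure k) t ≠ ζ ∧ algebraMap k (AlgebraicClosure k) t ≠ ζ ^ 2 := by
  rw [← not_or]
  intro h
  have ht0 : t ^ 2 + t + 1 = 0 := by
    apply (algebraMap k (AlgebraicClosure k)).injective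
    simpa using (primitiveRoot_iff hζ).mpr h
  fin_cases i
  · exact (not_fibreCubic_dvd ht0).1 (coe_mem_K0.mp ht)
  · exact ht.2 ⟨t, h, rfl⟩
  · exact (not_fibreCubic_dvd ht0).2 (coe_mem_K2.mp ht)

theorem geometricPoint_not_branch {ζ : AlgebraicClosure k} (hζ : IsPrimitiveRoot ζ 3) {i : Fin 3}
    {t : OnePoint k} (ht : t ∈ K k ζ i) (w : AlgebraicClosure k) (hw : geometricPoint t = w) :
    w ^ 2 + w + 1 ≠ 0 := by
  induction t using OnePoint.rec with
  | infty => exact absurd hw (OnePoint.infty_ne_coe w)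
  | coe t =>
    rw [geometricPoint_coe, OnePoint.coe_eq_coe] at hw
    rw [Ne, primitiveRoot_iff hζ, ← hw, not_or]
    exact ne_of_mem_K hζ ht

variable [NeZero (3 : k)]

theorem mem_K0_iff {s : OnePoint (AlgebraicClosure k)} (hs : IsUnramifiedPoint s) {t : OnePoint k}
    (hst : phiPoint s = geometricPoint t) : t ∈ K0 k ↔ frobeniusPoint k s = s := by
  induction t using OnePoint.rec with
  | infty => exact iff_of_true (Or.inr rfl) (frobeniusPoint_of_phiPoint_eq_infty hst)
  | coe t =>
    rw [coe_mem_K0, fibreCubic_dvd_iff hs hst]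
    simp only [map_sub, map_pow, Polynomial.aeval_X, sub_eq_zero]
    have key : ∀ x : AlgebraicClosure k, x ^ Fintype.card k = x ↔
        frobeniusPoint k (x : OnePoint (AlgebraicClosure k)) = x := by
      intro x
      rw [frobeniusPoint_coe, OnePoint.coe_eq_coe]
    simp only [key]
    constructor
    · intro h
      obtain ⟨x, rfl, -⟩ := (phiPoint_eq_coe_iff (three_ne_zero_of_algebra k)).mp hst
      exact h x (Or.inl rfl)
    · rintro h x (hx | hx | hx) <;> rw [← hx] <;> simp only [frobeniusPoint_sigmaPoint, h]

theorem mem_K2_iff {s : OnePoint (AlgebraicClosure k)} (hs : IsUnramifiedPoint s) {t : OnePoint k}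
    (hst : phiPoint s = geometricPoint t) : t ∈ K2 k ↔ frobeniusPoint k s = sigmaPoint s := by
  induction t using OnePoint.rec with
  | infty =>
    refine iff_of_false (by simp [K2]) ?_
    rw [frobeniusPoint_of_phiPoint_eq_infty hst]
    exact hs.sigmaPoint_ne.symm
  | coe t =>
    rw [coe_mem_K2, fibreCubic_dvd_iff hs hst]
    simp only [map_sub, map_add, map_one, map_pow, Polynomial.aeval_X]
    have key : ∀ x : AlgebraicClosure k, x ^ (Fintype.card k + 1) - x + 1 = 0 ↔
        frobeniusPoint k (x : OnePoint (AlgebraicClosure k)) =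
          sigmaPoint (x : OnePoint (AlgebraicClosure k)) := by
      intro x
      by_cases h0 : x = 0
      · simp [h0, frobeniusPoint_coe, sigmaPoint_zero]
      · rw [frobeniusPoint_coe, sigmaPoint_coe h0, OnePoint.coe_eq_coe, eq_div_iff h0]
        constructor <;> intro h <;> linear_combination h
    simp only [key]
    constructor
    · intro h
      obtain ⟨x, rfl, -⟩ := (phiPoint_eq_coe_iff (three_ne_zero_of_algebra k)).mp hst
      exact h x (Or.inl rfl)
    · rintro h x (hx | hx | hx) <;> rw [← hx] <;> simp only [frobeniusPoint_sigmaPoint, h]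

/-- For an unramified point `s` above the rational point `t`, the set `K^{(i)}` that contains `t` is
determined by the action of Frobenius on the fibre of `s`. -/
theorem mem_K_iff {ζ : AlgebraicClosure k} (hζ : IsPrimitiveRoot ζ 3) (i : Fin 3)
    {s : OnePoint (AlgebraicClosure k)} (hs : IsUnramifiedPoint s) {t : OnePoint k}
    (hst : phiPoint s = geometricPoint t) : t ∈ K k ζ i ↔ twistedFrobeniusPoint k i s = s := by
  have h3 : (3 : AlgebraicClosure k) ≠ 0 := three_ne_zero_of_algebra k
  rw [twistedFrobeniusPoint_eq]
  have h0 := mem_K0_iff hs hst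
  have h2 := mem_K2_iff hs hst
  have hσ := sigmaPoint_sigmaPoint_sigmaPoint s
  fin_cases i
  · exact h0
  · change t ∈ K1 k ζ ↔ sigmaPoint (frobeniusPoint k s) = s
    have h1 : t ∈ K1 k ζ ↔ t ∉ K0 k ∧ t ∉ K2 k := by
      constructor
      · rintro ⟨⟨⟨-, h0⟩, h2⟩, -⟩
        exact ⟨h0, h2⟩
      · rintro ⟨h0, h2⟩
        refine ⟨⟨⟨?_, h0⟩, h2⟩, ?_⟩
        · induction t using OnePoint.rec with
          | infty => exact absurd (Or.inr rfl) h0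
          | coe t => exact ⟨t, trivial, rfl⟩
        · rintro ⟨t, ht, rfl⟩
          exact (isUnramifiedPoint_iff h3).mp hs _ hst ((primitiveRoot_iff hζ).mpr ht)
    rw [h1, h0, h2]
    constructor
    · rintro ⟨g0, g2⟩
      have hF : phiPoint (frobeniusPoint k s) = phiPoint s := by
        rw [← frobeniusPoint_phiPoint, hst, frobeniusPoint_geometricPoint]
      rcases eq_or_eq_or_eq_of_phiPoint_eq h3 hF with h | h | h
      · exact absurd h g0
      · exact absurd h g2
      · rw [h, hσ]
    · intro h
      have h' : frobeniusPoint k s = sigmaPoint (sigmaPoint s) :=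
        sigmaPoint_injective (h.trans hσ.symm)
      rw [h']
      exact ⟨hs.sigmaPoint_sigmaPoint_ne, hs.sigmaPoint_sigmaPoint_ne_sigmaPoint⟩
  · change t ∈ K2 k ↔ sigmaPoint (sigmaPoint (frobeniusPoint k s)) = s
    rw [h2]
    constructor
    · intro h
      rw [h, hσ]
    · intro h
      exact sigmaPoint_injective (sigmaPoint_injective (h.trans hσ.symm))

end KSets

/-! ### Counting fixed points -/

section Count

open WeierstrassCurve

variable {k : Type*} [Field k] [Fintype k] [NeZero (3 : k)] (W : WeierstrassCurve (RatFunc k))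
  [W.IsElliptic]

theorem finite_fibre (t : OnePoint k) : Finite (Fibre W t) := by
  obtain ⟨C, hC⟩ := exists_isMinimal (localRing k t) W
  exact Finite.of_surjective _ (bijective_mkFibre (C := C)).surjective

theorem finite_fixed (i : Fin 3) : {P | twistedFrobenius W i P = P}.Finite := by
  have h3 : (3 : AlgebraicClosure k) ≠ 0 := three_ne_zero_of_algebra k
  have : Finite (OnePoint k) := inferInstanceAs (Finite (Option k))
  refine (Set.finite_iUnion fun t : OnePoint k =>
    (finite_phiPoint_fibre h3 (geometricPoint t)).biUnion fun s _ =>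
      finite_fixed_fibre (W := W) i s).subset fun P hP => ?_
  obtain ⟨t, ht⟩ := exists_geometricPoint_eq_phiPoint (twistedFrobeniusPoint_eq_of_fixed hP)
  exact Set.mem_iUnion.mpr ⟨t, Set.mem_biUnion ht ⟨hP, rfl⟩⟩

/-- The fixed points above the unramified points correspond to triples of a point `t` of `K^{(i)}`,
one of the three points above `t`, and a rational point of the fibre of `W` above `t`. -/
theorem ncard_fixed_unramified {ζ : AlgebraicClosure k} (hζ : IsPrimitiveRoot ζ 3) (i : Fin 3) :
    {P | twistedFrobenius W i P = P ∧ IsUnramifiedPoint P.1}.ncard =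
      3 * ∑ᶠ t ∈ K k ζ i, Nat.card (Fibre W t) := by
  have h3 : (3 : AlgebraicClosure k) ≠ 0 := three_ne_zero_of_algebra k
  have hfin : Finite (OnePoint k) := inferInstanceAs (Finite (Option k))
  choose C hC using fun t : OnePoint k => exists_isMinimal (localRing k t) W
  let Pt : OnePoint k → Type _ := fun t => {Q : Option (k × k) //
    ∀ P ∈ Q, (reducedCurve (C t • W) t).toAffine.Equation P.1 P.2}
  let ι : Option (k × k) → Option (AlgebraicClosure k × AlgebraicClosure k) :=
    Option.map (Prod.map (algebraMap k (AlgebraicClosure k)) (algebraMap k (AlgebraicClosure k)))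
  have hι : Function.Injective ι := Option.map_injective
    (Function.Injective.prodMap (algebraMap k _).injective (algebraMap k _).injective)
  have hram : ∀ (t : K k ζ i) (s : {s // phiPoint s = geometricPoint t.1}),
      IsUnramifiedPoint s.1 := fun t s =>
    (isUnramifiedPoint_iff h3).mpr fun w hw =>
      geometricPoint_not_branch hζ t.2 w (s.2.symm.trans hw)
  have hex : ∀ (t : K k ζ i) (s : {s // phiPoint s = geometricPoint t.1}) (Q : Pt t.1),
      ∃ P : WeierstrassModel (cubicBaseChange W) (AlgebraicClosure k),
        HasCoords P s.1 ((C t).map (phiHom k)) (ι Q.1) := by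
    intro t s Q
    have hmin := isMinimal_cubicBaseChange (hram t s) s.2 (hC t)
    refine ⟨_, hmin, ?_, rfl⟩
    rw [reducedCurve_cubicBaseChange (hram t s) s.2]
    exact equation_map_iff.mpr Q.2
  choose G hG using hex
  let F : (Σ t : K k ζ i, {s // phiPoint s = geometricPoint t.1} × Pt t.1) →
      {P | twistedFrobenius W i P = P ∧ IsUnramifiedPoint P.1} := fun x =>
    ⟨G x.1 x.2.1 x.2.2, ((fixed_iff_exists_hasCoords (hram x.1 x.2.1)
      ((mem_K_iff hζ i (hram x.1 x.2.1) x.2.1.2).mp x.1.2) x.2.1.2).mpr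
        ⟨x.2.2, hG x.1 x.2.1 x.2.2⟩).1, by
      rw [(hG x.1 x.2.1 x.2.2).fst_eq]
      exact hram x.1 x.2.1⟩
  have hF : Function.Bijective F := by
    constructor
    · rintro ⟨t, s, Q⟩ ⟨t', s', Q'⟩ h
      have h : G t s Q = G t' s' Q' := congrArg Subtype.val h
      have hs : s.1 = s'.1 := by
        rw [← (hG t s Q).fst_eq, h, (hG t' s' Q').fst_eq]
      have ht : t = t' := Subtype.ext (geometricPoint_injective (by rw [← s.2, ← s'.2, hs]))
      subst ht
      obtain rfl : s = s' := Subtype.ext hs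
      have hQ := hG t s Q
      rw [h] at hQ
      obtain rfl : Q = Q' := Subtype.ext (hι (hQ.coords_eq (hG t s Q')))
      rfl
    · rintro ⟨P, hP, hPr⟩
      have hfix := twistedFrobeniusPoint_eq_of_fixed hP
      obtain ⟨t, ht⟩ := exists_geometricPoint_eq_phiPoint hfix
      have htK := (mem_K_iff hζ i hPr ht).mpr hfix
      obtain ⟨Q, hQ⟩ := (fixed_iff_exists_hasCoords (C := C t) hPr hfix ht).mp ⟨hP, rfl⟩
      exact ⟨⟨⟨t, htK⟩, ⟨P.1, ht⟩, Q⟩, Subtype.ext ((hG _ _ _).eq hQ)⟩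
  have hPt : ∀ t, Finite (Pt t) := fun t => inferInstanceAs (Finite {Q : Option (k × k) // _})
  have hs : ∀ t : K k ζ i, Finite {s // phiPoint s = geometricPoint t.1} := fun t =>
    finite_phiPoint_fibre h3 _
  have : Fintype (K k ζ i) := Fintype.ofFinite _
  rw [← Nat.card_coe_set_eq, ← Nat.card_congr (Equiv.ofBijective F hF), Nat.card_sigma,
    ← finsum_set_coe_eq_finsum_mem, finsum_eq_sum_of_fintype, Finset.mul_sum]
  refine Finset.sum_congr rfl fun t _ => ?_
  rw [Nat.card_prod, Nat.card_congr (Equiv.ofBijective _ (bijective_mkFibre (C := C t)))]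
  congr 1
  exact (Nat.card_coe_set_eq _).trans (ncard_phiPoint_fibre h3 (geometricPoint_not_branch hζ t.2))

end Count

end EllipticSurface

theorem lemma2p2p4 {k : Type*} [Field k] [Fintype k] [NeZero (3 : k)]
    (W : WeierstrassCurve (RatFunc k)) [W.IsElliptic]
    (ζ : AlgebraicClosure k) (hζ : IsPrimitiveRoot ζ 3) (i : Fin 3) :
    (∀ t : k, (t : OnePoint k) ∈ EllipticSurface.K k ζ i →
      algebraMap k (AlgebraicClosure k) t ≠ ζ ∧ algebraMap k (AlgebraicClosure k) t ≠ ζ ^ 2) ∧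
    (∀ t : OnePoint k, Finite (EllipticSurface.Fibre W t)) ∧
    {P | EllipticSurface.twistedFrobenius W i P = P}.Finite ∧
    Set.ncard {P | EllipticSurface.twistedFrobenius W i P = P} =
      3 * (∑ᶠ t ∈ EllipticSurface.K k ζ i, Nat.card (EllipticSurface.Fibre W t)) +
      Set.ncard {P | EllipticSurface.twistedFrobenius W i P = P ∧
        (P.1 = ((-ζ : AlgebraicClosure k) : OnePoint (AlgebraicClosure k)) ∨
          P.1 = ((-ζ ^ 2 : AlgebraicClosure k) : OnePoint (AlgebraicClosure k)))} := by
  have hfin := EllipticSurface.finite_fixed W i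
  refine ⟨fun t ht => EllipticSurface.ne_of_mem_K hζ ht, EllipticSurface.finite_fibre W, hfin, ?_⟩
  simp only [← EllipticSurface.not_isUnramifiedPoint_iff hζ]
  rw [← EllipticSurface.ncard_fixed_unramified W hζ i, ← Set.ncard_union_eq ?_
    (hfin.subset fun P hP => hP.1) (hfin.subset fun P hP => hP.1)]
  · congr 1
    ext P
    simp only [Set.mem_union, Set.mem_ofPred_eq, ← and_or_left, em, and_true]
  · exact Set.disjoint_left.mpr fun P hP hP' => hP'.2 hP.2
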